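/- Let $n\ge 1$, $-\frac1n<\alpha<0$, and let $\mathcal P_1(\mathbb R^n)$ be the set of Borel probability measures on $\mathbb R^n$ with finite first moment. For $\varrho,\mu\in\mathcal P_1(\mathbb R^n)$ put $$\mathcal F_\alpha(\varrho)=-\int_{\mathbb R^n}\rho(x)^{\frac1{1-\alpha}}\,dx,\qquad \mathcal T(\varrho,\mu)=\sup_{\pi\in\Pi(\varrho,\mu)}\int_{\mathbb R^n\times\mathbb R^n}\langle x,y\rangle\,d\pi(x,y)\in[0,+\infty],$$ where $\rho$ is the density of the absolutely continuous part of $\varrho$ with respect to Lebesgue measure $\mathcal L^n$, $\Pi(\varrho,\mu)$ is the set of measures on $\mathbb R^n\times\mathbb R^n$ with marginals $\varrho$ and $\mu$, and the supremum is over those $\pi$ for which the integral is defined in $[-\infty,+\infty]$. Let $\mu\in\mathcal P_1(\mathbb R^n)$ have its barycenter at the origin and not be supported in any hyperplane. Suppose that $\varrho_0\in\mathcal P_1(\mathbb R^n)$ minimizes $(1-\alpha)\mathcal F_\alpha(\varrho)-\alpha\,\mathcal T(\varrho,\mu)$ over all $\varrho\in\mathcal P_1(\mathbb R^n)$ and is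 of the form $$\varrho_0=(1-\alpha\varphi_0)^{\frac1\alpha-1}\,dx+\varrho_0^s,$$ where $\varphi_0:\mathbb R^n\to\mathbb R\cup\{+\infty\}$ is convex and lower semicontinuous with $\varphi_0\ge\frac1\alpha$, and $\varrho_0^s$ and $\mathcal L^n$ are mutually singular. (Here $(1-\alpha\varphi_0)^{p}$, $p<0$, is $0$ where $\varphi_0=+\infty$ and $+\infty$ where $\varphi_0=\frac1\alpha$.) Then $\varphi_0$ is essentially continuous, that is, $\varphi_0$ is lower semicontinuous and the set of its points of discontinuity has zero $(n-1)$-dimensional Hausdorff measure $\mathcal H^{n-1}$. Moreover, the spherical surface area measure of $\varrho_0$ vanishes: for $\rho=(1-\alpha\varphi_0)^{\frac1\alpha-1}$, with $K_\rho=\overline{\{\rho\neq0\}}$ and $\nu_{K_\rho}$ the Gauss map of $K_\rho$ (the outer unit normal, at the points of $\partial K_\rho$ where it is unique), the push-forward $(\nu_{K_\rho})_\sharp\big(\rho\,d\mathcal H^{n-1}|_{\partial K_\rho}\big)$ is the zero measure on $S^{n-1}$. The same holds for $\rho=(1-\alpha\varphi_0)^{\frac1\alpha}$. -/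

import Mathlib

open MeasureTheory
open scoped ENNReal

namespace AlphaConcave

noncomputable section

/-- Euclidean space of dimension `n`. -/
abbrev E (n : ℕ) : Type := EuclideanSpace ℝ (Fin n)

/-- `φ : ℝⁿ → ℝ ∪ {+∞}` is convex. Functions take values in `EReal`, the value `-∞` is excluded,
and `0 * (+∞) = 0`. -/
def IsConvex {n : ℕ} (φ : E n → EReal) : Prop :=
  (∀ x, φ x ≠ ⊥) ∧
    ∀ x y : E n, ∀ t : ℝ, 0 ≤ t → t ≤ 1 →
      φ (t • x + (1 - t) • y) ≤ (t : EReal) * φ x + ((1 - t : ℝ) : EReal) * φ y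

/-- Lower semicontinuous, and the set of points of discontinuity is an `𝓗ⁿ⁻¹`-null set.
`μHE[n - 1]` is the `(n-1)`-dimensional Hausdorff measure, normalised to agree with
Lebesgue measure on `(n-1)`-dimensional spaces. -/
def EssentiallyContinuous {n : ℕ} (φ : E n → EReal) : Prop :=
  LowerSemicontinuous φ ∧ μHE[n - 1] {x : E n | ¬ ContinuousAt φ x} = 0

/-- `(1 - α φ) ^ p` as a function with values in `[0, ∞]`. For `α < 0`, `p < 0` and `φ ≥ 1 / α` it
is `0` where `φ = +∞`, and it is `∞` where `φ = 1 / α`. -/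
def density {n : ℕ} (α p : ℝ) (φ : E n → EReal) (x : E n) : ℝ≥0∞ :=
  (1 - (α : EReal) * φ x).toENNReal ^ p

/-! ### Optimal transport -/

/-- Probability measures on `ℝⁿ` with finite first moment. -/
def P₁ (n : ℕ) : Set (Measure (E n)) :=
  {ϱ | IsProbabilityMeasure ϱ ∧ ∫⁻ x, ‖x‖ₑ ∂ϱ < ⊤}

/-- The measure is not concentrated on any (affine) hyperplane. -/
def NotSupportedInHyperplane {n : ℕ} (μ : Measure (E n)) : Prop :=
  ∀ ξ : E n, ξ ≠ 0 → ∀ c : ℝ, μ {x : E n | inner ℝ ξ x = c}ᶜ ≠ 0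

/-- Transference plans of `ϱ` and `μ`. -/
def transferencePlans {n : ℕ} (ϱ μ : Measure (E n)) : Set (Measure (E n × E n)) :=
  {π | π.map Prod.fst = ϱ ∧ π.map Prod.snd = μ}

/-- The integral of `f` with values in `[-∞, +∞]`: the integral of the positive part minus the
integral of the negative part. If both are infinite (the integral is undefined) the value is `-∞`,
so that such a measure does not contribute to a supremum. -/
def extIntegral {X : Type*} [MeasurableSpace X] (π : Measure X) (f : X → ℝ) : EReal :=
  ((∫⁻ x, ENNReal.ofReal (f x) ∂π : ℝ≥0∞) : EReal) -
    ((∫⁻ x, ENNReal.ofReal (-f x) ∂π : ℝ≥0∞) : EReal)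

/-- The maximal correlation functional `𝓣(ϱ, μ) = sup_π ∫ ⟨x, y⟩ dπ(x, y)`. -/
def maxCorrelation {n : ℕ} (ϱ μ : Measure (E n)) : EReal :=
  ⨆ π ∈ transferencePlans ϱ μ, extIntegral π fun z : E n × E n => inner ℝ z.1 z.2

/-- `𝓕_α(ϱ) = -∫ ρ ^ (1 / (1 - α)) dx`, where `ρ` is the density of the absolutely continuous part
of `ϱ` in its Lebesgue decomposition. -/
def entropy {n : ℕ} (α : ℝ) (ϱ : Measure (E n)) : EReal :=
  -((∫⁻ x, ϱ.rnDeriv volume x ^ (1 / (1 - α)) ∂volume : ℝ≥0∞) : EReal)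

/-- The functional `(1 - α) 𝓕_α(ϱ) - α 𝓣(ϱ, μ)`. -/
def objective {n : ℕ} (α : ℝ) (μ ϱ : Measure (E n)) : EReal :=
  ((1 - α : ℝ) : EReal) * entropy α ϱ - (α : EReal) * maxCorrelation ϱ μ

/-- `ϱ₀` minimises `(1 - α) 𝓕_α(ϱ) - α 𝓣(ϱ, μ)` over all `ϱ ∈ P₁(ℝⁿ)`. -/
def IsSolution {n : ℕ} (α : ℝ) (μ ϱ₀ : Measure (E n)) : Prop :=
  ϱ₀ ∈ P₁ n ∧ IsMinOn (objective α μ) (P₁ n) ϱ₀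

/-! ### Gauss map and spherical surface area measure -/

/-- `S^{n-1}`. -/
abbrev Sphere (n : ℕ) : Type := Metric.sphere (0 : E n) 1

/-- `u` is an outer unit normal of `K` at `x`. -/
def IsOuterNormal {n : ℕ} (K : Set (E n)) (x : E n) (u : Sphere n) : Prop :=
  ∀ y ∈ K, inner ℝ (u : E n) (y - x) ≤ 0

/-- The boundary points of `K` with exactly one outer unit normal. For closed convex `K` with
nonempty interior these are `𝓗ⁿ⁻¹`-almost all points of `∂K`. -/
def regularBoundary {n : ℕ} (K : Set (E n)) : Set (E n) :=
  {x | x ∈ frontier K ∧ ∃! u : Sphere n, IsOuterNormal K x u}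

/-- The Gauss map `ν_K`, on the set of boundary points where it is single valued. -/
def gaussMap {n : ℕ} (K : Set (E n)) (x : regularBoundary K) : Sphere n :=
  x.2.2.choose

/-- The spherical surface area measure `(ν_K)_♯ (ρ d𝓗ⁿ⁻¹|_∂K)` on `S^{n-1}` with `K = Supp ρ` the
closure of `{ρ ≠ 0}`. The lemmas below show that the map and the set it lives on are
measurable, so that the push-forward has its usual meaning. -/
def sphericalSurfaceAreaMeasure {n : ℕ} (ρ : E n → ℝ≥0∞) : Measure (Sphere n) :=
  (((μHE[n - 1].restrict (frontier (tsupport ρ))).withDensity ρ).comap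
    (Subtype.val : regularBoundary (tsupport ρ) → E n)).map (gaussMap (tsupport ρ))

lemma isClosed_isOuterNormal {n : ℕ} (K : Set (E n)) :
    IsClosed {z : E n × Sphere n | IsOuterNormal K z.1 z.2} := by
  have : {z : E n × Sphere n | IsOuterNormal K z.1 z.2} =
      ⋂ y ∈ K, {z : E n × Sphere n | inner ℝ (z.2 : E n) (y - z.1) ≤ 0} := by
    ext z; simp [IsOuterNormal]
  rw [this]
  exact isClosed_biInter fun y _ => isClosed_le (by fun_prop) continuous_const

lemma isClosed_exists_isOuterNormal {n : ℕ} (K : Set (E n)) (C : Set (Sphere n))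
    (hC : IsClosed C) : IsClosed {x : E n | ∃ u ∈ C, IsOuterNormal K x u} := by
  have h := isClosedMap_fst_of_compactSpace (X := E n) (Y := Sphere n) _
    ((isClosed_isOuterNormal K).inter (hC.preimage continuous_snd))
  convert h using 1
  ext x
  constructor
  · rintro ⟨u, hu, hx⟩
    exact ⟨(x, u), ⟨hx, hu⟩, rfl⟩
  · rintro ⟨z, ⟨hz, hu⟩, rfl⟩
    exact ⟨z.2, hu, hz⟩

lemma isClosed_exists_two_isOuterNormal {n : ℕ} (K : Set (E n)) (r : ℝ) :
    IsClosed {x : E n | ∃ u v : Sphere n,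
      IsOuterNormal K x u ∧ IsOuterNormal K x v ∧ r ≤ dist u v} := by
  have h1 : IsClosed {z : E n × (Sphere n × Sphere n) | IsOuterNormal K z.1 z.2.1} :=
    (isClosed_isOuterNormal K).preimage
      (f := fun z : E n × (Sphere n × Sphere n) => (z.1, z.2.1)) (by fun_prop)
  have h2 : IsClosed {z : E n × (Sphere n × Sphere n) | IsOuterNormal K z.1 z.2.2} :=
    (isClosed_isOuterNormal K).preimage
      (f := fun z : E n × (Sphere n × Sphere n) => (z.1, z.2.2)) (by fun_prop)
  have h3 : IsClosed {z : E n × (Sphere n × Sphere n) | r ≤ dist z.2.1 z.2.2} :=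
    isClosed_le continuous_const (by fun_prop)
  have h := isClosedMap_fst_of_compactSpace (X := E n) (Y := Sphere n × Sphere n) _
    ((h1.inter h2).inter h3)
  convert h using 1
  ext x
  constructor
  · rintro ⟨u, v, hu, hv, huv⟩
    exact ⟨(x, (u, v)), ⟨⟨hu, hv⟩, huv⟩, rfl⟩
  · rintro ⟨z, ⟨⟨hu, hv⟩, huv⟩, rfl⟩
    exact ⟨z.2.1, z.2.2, hu, hv, huv⟩

lemma measurableSet_regularBoundary {n : ℕ} (K : Set (E n)) :
    MeasurableSet (regularBoundary K) := by
  have : regularBoundary K =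
      (frontier K ∩ {x : E n | ∃ u ∈ (Set.univ : Set (Sphere n)), IsOuterNormal K x u}) \
        ⋃ k : ℕ, {x : E n | ∃ u v : Sphere n,
          IsOuterNormal K x u ∧ IsOuterNormal K x v ∧ 1 / ((k : ℝ) + 1) ≤ dist u v} := by
    ext x
    simp only [regularBoundary, Set.mem_ofPred_eq, Set.mem_sdiff, Set.mem_inter_iff, Set.mem_univ,
      true_and, Set.mem_iUnion, not_exists]
    constructor
    · rintro ⟨hx, u, hu, huniq⟩
      refine ⟨⟨hx, u, hu⟩, ?_⟩
      rintro k v w ⟨hv, hw, hvw⟩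
      rw [huniq v hv, huniq w hw, dist_self] at hvw
      have : 0 < 1 / ((k : ℝ) + 1) := by positivity
      linarith
    · rintro ⟨⟨hx, u, hu⟩, h⟩
      refine ⟨hx, u, hu, fun v hv => ?_⟩
      by_contra hne
      obtain ⟨k, hk⟩ := exists_nat_one_div_lt (dist_pos.mpr hne)
      exact h k v u ⟨hv, hu, hk.le⟩
  rw [this]
  exact (isClosed_frontier.inter
    (isClosed_exists_isOuterNormal K _ isClosed_univ)).measurableSet.diff
    (MeasurableSet.iUnion fun k => (isClosed_exists_two_isOuterNormal K _).measurableSet)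

lemma measurable_gaussMap {n : ℕ} (K : Set (E n)) : Measurable (gaussMap K) := by
  refine measurable_of_isClosed fun C hC => ?_
  have : gaussMap K ⁻¹' C =
      Subtype.val ⁻¹' {x : E n | ∃ u ∈ C, IsOuterNormal K x u} := by
    ext x
    have hs := x.2.2.choose_spec
    constructor
    · intro h
      exact ⟨gaussMap K x, h, hs.1⟩
    · rintro ⟨u, hu, hx⟩
      have : u = gaussMap K x := hs.2 u hx
      rw [Set.mem_preimage, ← this]
      exact hu
  rw [this]
  exact measurable_subtype_coe (isClosed_exists_isOuterNormal K C hC).measurableSet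

/-- `η ↦ ∫_{ν_K⁻¹(η)} ρ d𝓗ⁿ⁻¹`. -/
lemma sphericalSurfaceAreaMeasure_apply {n : ℕ} (ρ : E n → ℝ≥0∞) {η : Set (Sphere n)}
    (hη : MeasurableSet η) :
    sphericalSurfaceAreaMeasure ρ η =
      ∫⁻ x in Subtype.val '' (gaussMap (tsupport ρ) ⁻¹' η), ρ x ∂μHE[n - 1] := by
  have hR := measurableSet_regularBoundary (tsupport ρ)
  have hm := measurable_gaussMap (tsupport ρ) hη
  have hi : MeasurableSet
      (Subtype.val '' (gaussMap (tsupport ρ) ⁻¹' η) : Set (E n)) := hR.subtype_image hm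
  rw [sphericalSurfaceAreaMeasure, Measure.map_apply (measurable_gaussMap _) hη,
    (MeasurableEmbedding.subtype_coe hR).comap_apply, withDensity_apply _ hi,
    Measure.restrict_restrict hi, Set.inter_eq_left.mpr]
  rintro _ ⟨x, _, rfl⟩
  exact x.2.1

end

end AlphaConcave

/-! The minimizer is tested against displacements of its own mass. Let `p = 1 / (1 - α) < 1` and let
`K` be the closure of the domain of `φ₀`. Shift half of the mass in the layer `L_t = {z ∈ S | z + t
w ∉ K}` by `t w`, where `S` is a sublevel set of `φ₀`. The moved mass lands where the density
vanishes, so strict concavity of `s ↦ s ^ p` raises `∫ ρ ^ p` by a fixed multiple of `∫_{L_t} ρ ^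
p`. Since `ρ` is bounded below on `S`, this gain is at least a multiple of `|L_t|`.

The correlation grows by at most `t ‖w‖ (M ρ(L_t) + ∫_{‖y‖ > M} ‖y‖ dμ)` for every `M`
(`maxCorrelation_le_add`). As `ρ(L_t) → 0` and `M` is arbitrary, minimality forces `|L_t| = o(t)`
(`IsSolution.volume_layer_isLittleO`).

Conversely, with a suitable `w`, each point of `S ∩ ∂K` in a small region has a ball of radius
comparable to `t` inside `L_t` at distance `O(t)` (`ball_subset_layer`). Packing then covers these
points by `o(t ^ (1 - n))` balls of radius `O(t)`, so they are `𝓗ⁿ⁻¹`-null. Countably many regions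
and sublevels exhaust the frontier points where `φ₀` is finite. These include all discontinuities
and carry all the surface area.

The geometry needs a domain with interior. Otherwise the absolutely continuous part would vanish,
and spreading the mass over small balls would improve the objective
(`IsSolution.lintegral_rnDeriv_rpow_ne_zero`). -/

namespace AlphaConcave

open Set Filter Topology ProbabilityTheory

/-! ### Couplings and stability of the maximal correlation -/

/-- Gluing of two couplings with a common marginal. -/
lemma exists_gluing {X Y Z : Type*} [MeasurableSpace X] [MeasurableSpace Y] [MeasurableSpace Z]
    [StandardBorelSpace Z] [Nonempty Z] (γ : Measure (X × Z)) (π : Measure (X × Y))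
    [IsFiniteMeasure γ] [IsFiniteMeasure π] (h : γ.map Prod.fst = π.map Prod.fst) :
    ∃ Θ : Measure ((X × Y) × Z), Θ.map Prod.fst = π ∧
      Θ.map (fun z => (z.1.1, z.2)) = γ := by
  refine ⟨π ⊗ₘ (γ.condKernel.comap Prod.fst measurable_fst), ?_, ?_⟩
  · exact Measure.fst_compProd _ _
  · have hf : Measurable fun z : (X × Y) × Z => (z.1.1, z.2) := by fun_prop
    conv_rhs => rw [← γ.disintegrate γ.condKernel]
    ext s hs
    rw [Measure.map_apply hf hs, Measure.compProd_apply (hf hs), Measure.compProd_apply hs,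
      Measure.fst, h, lintegral_map (Kernel.measurable_kernel_prodMk_left hs) measurable_fst]
    rfl

/-- Rearrangement under the convention `∞ - ∞ = -∞`. The hypothesis `h1` excludes an infinite `b`
with a finite `b'`, the case in which the right side could drop to `-∞`. -/
lemma ereal_sub_le_sub_add {a b a' b' e : ℝ≥0∞} (he : e ≠ ⊤) (h1 : b ≤ b' + e)
    (h : a' + b ≤ a + b' + e) : (a' : EReal) - b' ≤ a - b + e := by
  rcases eq_or_ne b' ⊤ with rfl | hb'
  · simp [sub_eq_add_neg]
  have hb : b ≠ ⊤ := ne_top_of_le_ne_top (by simp [hb', he]) h1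
  lift b to NNReal using hb
  lift e to NNReal using he
  rcases eq_or_ne a ⊤ with rfl | ha
  · have : ((⊤ : ℝ≥0∞) : EReal) - ((b : ℝ≥0∞) : EReal) + ((e : ℝ≥0∞) : EReal) = ⊤ := by
      rw [EReal.coe_ennreal_top]
      exact EReal.top_sub_coe (b : ℝ) ▸ EReal.top_add_coe (e : ℝ)
    rw [this]; exact le_top
  have ha' : a' ≠ ⊤ := ne_top_of_le_ne_top (by simp [hb', ha])
    (le_self_add.trans h)
  lift b' to NNReal using hb'
  lift a to NNReal using ha
  lift a' to NNReal using ha'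
  have h' : (a' : ℝ) + b ≤ a + b' + e := by exact_mod_cast h
  have : (((a' : ℝ) - b' : ℝ) : EReal) ≤ (((a : ℝ) - b + e : ℝ) : EReal) := by
    exact_mod_cast (by linarith : (a' : ℝ) - b' ≤ (a : ℝ) - b + e)
  exact this

/-- This is `a ≤ b + |a - b|` with negative parts moved across, so that it can be integrated in `[0,
∞]` without subtraction. -/
lemma ofReal_add_ofReal_neg_le (a b : ℝ) :
    ENNReal.ofReal a + ENNReal.ofReal (-b) ≤
      ENNReal.ofReal b + ENNReal.ofReal (-a) + ENNReal.ofReal |a - b| := by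
  have h : ∀ x : ℝ, ENNReal.ofReal x = ENNReal.ofReal (max x 0) := fun x => by
    rw [ENNReal.ofReal, ENNReal.ofReal]; congr 1; ext; simp
  rw [h a, h (-b), h b, h (-a), ← ENNReal.ofReal_add (by simp) (by simp),
    ← ENNReal.ofReal_add (by simp) (by simp), ← ENNReal.ofReal_add (by positivity) (by simp)]
  apply ENNReal.ofReal_le_ofReal
  have := le_abs_self (a - b)
  rcases le_total a 0 with ha | ha <;> rcases le_total b 0 with hb | hb <;>
    simp [ha, hb] <;> linarith

lemma extIntegral_le_add {X : Type*} [MeasurableSpace X] (Θ : Measure X) {f f' : X → ℝ}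
    (hf : Measurable f) (hf' : Measurable f') {g : X → ℝ≥0∞} (hg : Measurable g)
    (hfg : ∀ᵐ x ∂Θ, ENNReal.ofReal |f' x - f x| ≤ g x) {e : ℝ≥0∞} (he : e ≠ ⊤)
    (hge : ∫⁻ x, g x ∂Θ ≤ e) :
    extIntegral Θ f' ≤ extIntegral Θ f + (e : EReal) := by
  have key : ∀ {u v : X → ℝ}, Measurable u → (∀ᵐ x ∂Θ, ENNReal.ofReal |u x - v x| ≤ g x) →
      ∫⁻ x, ENNReal.ofReal (v x) ∂Θ ≤ ∫⁻ x, ENNReal.ofReal (u x) ∂Θ + e := by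
    intro u v hu huv
    calc ∫⁻ x, ENNReal.ofReal (v x) ∂Θ ≤ ∫⁻ x, (ENNReal.ofReal (u x) + g x) ∂Θ := by
          refine lintegral_mono_ae (huv.mono fun x hx => ?_)
          calc ENNReal.ofReal (v x) ≤ ENNReal.ofReal (u x + |u x - v x|) := by
                apply ENNReal.ofReal_le_ofReal; linarith [neg_abs_le (u x - v x)]
            _ ≤ _ := ENNReal.ofReal_add_le.trans (add_le_add le_rfl hx)
      _ = ∫⁻ x, ENNReal.ofReal (u x) ∂Θ + ∫⁻ x, g x ∂Θ := lintegral_add_right _ hg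
      _ ≤ _ := add_le_add le_rfl hge
  have hsum : ∫⁻ x, ENNReal.ofReal (f' x) ∂Θ + ∫⁻ x, ENNReal.ofReal (-f x) ∂Θ ≤
      ∫⁻ x, ENNReal.ofReal (f x) ∂Θ + ∫⁻ x, ENNReal.ofReal (-f' x) ∂Θ + e := by
    rw [← lintegral_add_left (by fun_prop), ← lintegral_add_left (by fun_prop)]
    refine le_trans ?_ (add_le_add le_rfl hge)
    rw [← lintegral_add_right _ hg]
    refine lintegral_mono_ae (hfg.mono fun x hx => ?_)
    refine le_trans ?_ (add_le_add le_rfl hx)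
    exact ofReal_add_ofReal_neg_le _ _
  have h1 := key (u := fun x => - f' x) (v := fun x => - f x) hf'.neg
    (hfg.mono fun x hx => by
      rw [show - f' x - - f x = -(f' x - f x) by ring, abs_neg]; exact hx)
  exact ereal_sub_le_sub_add he h1 hsum

lemma extIntegral_map {X Y : Type*} [MeasurableSpace X] [MeasurableSpace Y] (Θ : Measure X)
    {T : X → Y} (hT : Measurable T) {f : Y → ℝ} (hf : Measurable f) :
    extIntegral (Θ.map T) f = extIntegral Θ (f ∘ T) := by
  unfold extIntegral
  rw [lintegral_map (by fun_prop) hT, lintegral_map (by fun_prop) hT]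
  rfl

/-- A plan of `ϱ'` and `μ` is glued to `γ` along `ϱ'`, which yields a plan of `ϱ` and `μ`. The
integrands differ by `⟨x' - x, y⟩`, which is zero where nothing moved and at most `ε ‖y‖` elsewhere.
Splitting `‖y‖` at `M` is what later improves `O(ε)` to `o(ε)`. -/
lemma maxCorrelation_le_add {n : ℕ} {ϱ ϱ' μ : Measure (E n)} [IsProbabilityMeasure μ]
    (γ : Measure (E n × E n)) [IsProbabilityMeasure γ] (h1 : γ.map Prod.fst = ϱ')
    (h2 : γ.map Prod.snd = ϱ) {ε : ℝ} (hγ : ∀ᵐ z ∂γ, ‖z.1 - z.2‖ ≤ ε)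
    (M : ℝ≥0∞) (hM : M ≠ ⊤) (hμ : ∫⁻ y, ‖y‖ₑ ∂μ < ⊤) :
    maxCorrelation ϱ' μ ≤ maxCorrelation ϱ μ +
      ((ENNReal.ofReal ε * (M * γ {z | z.1 ≠ z.2} +
        ∫⁻ y in {y | M < ‖y‖ₑ}, ‖y‖ₑ ∂μ) : ℝ≥0∞) : EReal) := by
  refine iSup₂_le fun π hπ => ?_
  obtain ⟨hπ1, hπ2⟩ := hπ
  have hπp : IsProbabilityMeasure π := by
    have : IsProbabilityMeasure (π.map Prod.snd) := by rw [hπ2]; infer_instance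
    exact Measure.isProbabilityMeasure_of_map Prod.snd
  -- Coordinates of `Θ` are `((x', y), x)`.
  obtain ⟨Θ, hΘ1, hΘ2⟩ := exists_gluing γ π (h1.trans hπ1.symm)
  have hY : Θ.map (fun z => z.1.2) = μ := by
    rw [← hπ2, ← hΘ1, Measure.map_map measurable_snd measurable_fst]; rfl
  have hmY : Measurable fun z : (E n × E n) × E n => z.1.2 := by fun_prop
  have hmX : Measurable fun z : (E n × E n) × E n => (z.1.1, z.2) := by fun_prop
  have hD : MeasurableSet {z : E n × E n | z.1 ≠ z.2} :=
    (measurableSet_eq_fun measurable_fst measurable_snd).compl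
  have hT : MeasurableSet {y : E n | M < ‖y‖ₑ} := measurableSet_lt measurable_const (by fun_prop)
  have hbound := extIntegral_le_add Θ
    (f := fun z => inner ℝ z.2 z.1.2) (f' := fun z => inner ℝ z.1.1 z.1.2)
    (by fun_prop) (by fun_prop)
    (g := fun z => ENNReal.ofReal ε * (M * indicator {z : E n × E n | z.1 ≠ z.2} 1 (z.1.1, z.2) +
        indicator {y : E n | M < ‖y‖ₑ} (fun y => ‖y‖ₑ) z.1.2))
    (e := ENNReal.ofReal ε * (M * γ {z | z.1 ≠ z.2} +
        ∫⁻ y in {y | M < ‖y‖ₑ}, ‖y‖ₑ ∂μ))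
    ?_ ?_ ?_ ?_
  · have e1 : extIntegral π (fun z : E n × E n => inner ℝ z.1 z.2) =
        extIntegral Θ fun z => inner ℝ z.1.1 z.1.2 := by
      rw [← hΘ1, extIntegral_map _ measurable_fst (by fun_prop)]; rfl
    rw [e1]
    refine hbound.trans (add_le_add ?_ le_rfl)
    have hmZ : Measurable fun z : (E n × E n) × E n => (z.2, z.1.2) := by fun_prop
    refine le_trans (le_of_eq ?_) (le_iSup₂ (Θ.map fun z => (z.2, z.1.2)) ⟨?_, ?_⟩)
    · rw [extIntegral_map _ hmZ (by fun_prop)]; rfl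
    · rw [Measure.map_map measurable_fst hmZ, ← h2, ← hΘ2, Measure.map_map measurable_snd hmX]
      rfl
    · rw [Measure.map_map measurable_snd hmZ]
      exact hY
  · refine Measurable.const_mul (Measurable.add (Measurable.const_mul ?_ _) ?_) _
    · exact (measurable_one.indicator hD).comp hmX
    · exact (Measurable.indicator (by fun_prop) hT).comp hmY
  · have hγ' : ∀ᵐ z ∂Θ, ‖z.1.1 - z.2‖ ≤ ε := by
      rw [← hΘ2] at hγ
      exact ae_of_ae_map hmX.aemeasurable hγ
    refine hγ'.mono fun z hz => ?_
    rw [← inner_sub_left]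
    have hin : ENNReal.ofReal |inner ℝ (z.1.1 - z.2) z.1.2| ≤ ‖z.1.1 - z.2‖ₑ * ‖z.1.2‖ₑ := by
      rw [← ofReal_norm, ← ofReal_norm, ← ENNReal.ofReal_mul (norm_nonneg _)]
      exact ENNReal.ofReal_le_ofReal (abs_real_inner_le_norm _ _)
    rcases eq_or_ne z.1.1 z.2 with h | h
    · simp [h]
    · refine hin.trans (mul_le_mul' ?_ ?_)
      · rw [← ofReal_norm]; exact ENNReal.ofReal_le_ofReal hz
      · rw [indicator_of_mem (by exact h)]
        rcases le_or_gt ‖z.1.2‖ₑ M with h' | h'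
        · exact le_add_right (by simpa using h')
        · rw [indicator_of_mem (by exact h')]
          exact le_add_left le_rfl
  · refine ENNReal.mul_ne_top ENNReal.ofReal_ne_top (ENNReal.add_ne_top.2 ⟨?_, ?_⟩)
    · exact ENNReal.mul_ne_top hM (measure_ne_top _ _)
    · exact ne_top_of_le_ne_top hμ.ne (setLIntegral_le_lintegral _ _)
  · rw [lintegral_const_mul' _ _ ENNReal.ofReal_ne_top, lintegral_add_right,
      lintegral_const_mul' _ _ hM]
    · gcongr
      · rw [← lintegral_map (f := indicator {z : E n × E n | z.1 ≠ z.2} 1)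
          (measurable_one.indicator hD) hmX, hΘ2, lintegral_indicator_one hD]
      · rw [← lintegral_map (f := indicator {y : E n | M < ‖y‖ₑ} (fun y => ‖y‖ₑ))
          (Measurable.indicator (by fun_prop) hT) hmY, hY, lintegral_indicator hT]
    · exact (Measurable.indicator (by fun_prop) hT).comp hmY

/-! ### Finiteness of the entropy and of the correlation -/

/-- Hölder with exponents `1 / p` and `1 / (1 - p)` applied to `f (1 + ‖x‖)` and the weight `(1 +
‖x‖) ^ (-p / (1 - p))`, which is integrable because the decay exceeds `n`. -/
lemma lintegral_rpow_lt_top {n : ℕ} {p : ℝ} (hp0 : 0 < p) (hp1 : p < 1) (hnp : n < p / (1 - p))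
    {f : E n → ℝ≥0∞} (hf : Measurable f) (hfi : ∫⁻ x, f x * (1 + ‖x‖ₑ) < ⊤) :
    ∫⁻ x, f x ^ p < ⊤ := by
  have hw : ∀ x : E n, ENNReal.ofReal ((1 + ‖x‖) ^ (-(p / (1 - p)))) =
      (1 + ‖x‖ₑ) ^ (-(p / (1 - p))) := fun x => by
    rw [← ENNReal.ofReal_rpow_of_pos (by positivity), ENNReal.ofReal_add (by simp) (by simp)]
    simp
  have hG := finite_integral_one_add_norm (E := E n) (μ := volume) (r := p / (1 - p))
    (by simpa using hnp)
  simp_rw [hw] at hG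
  have h := ENNReal.lintegral_mul_norm_pow_le (μ := (volume : Measure (E n)))
    (f := fun x => f x * (1 + ‖x‖ₑ)) (g := fun x => (1 + ‖x‖ₑ) ^ (-(p / (1 - p))))
    (by fun_prop) (by fun_prop) hp0.le (q := 1 - p) (by linarith) (by ring)
  have h1p : 1 - p ≠ 0 := by linarith
  have e : ∀ x : E n, (f x * (1 + ‖x‖ₑ)) ^ p * ((1 + ‖x‖ₑ) ^ (-(p / (1 - p)))) ^ (1 - p) =
      f x ^ p := fun x => by
    have h0 : 1 + ‖x‖ₑ ≠ 0 := by simp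
    have ht : 1 + ‖x‖ₑ ≠ ⊤ := by simp
    rw [ENNReal.mul_rpow_of_nonneg _ _ hp0.le, ← ENNReal.rpow_mul, mul_assoc,
      ← ENNReal.rpow_add _ _ h0 ht]
    rw [show p + -(p / (1 - p)) * (1 - p) = 0 by field_simp; ring]
    simp
  simp_rw [e] at h
  refine h.trans_lt (ENNReal.mul_lt_top ?_ ?_)
  · exact ENNReal.rpow_lt_top_of_nonneg hp0.le hfi.ne
  · exact ENNReal.rpow_lt_top_of_nonneg (by linarith) hG.ne

/-- For `p = 1 / (1 - α)` the decay exponent `p / (1 - p)` equals `-1 / α`, so the requirement is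
exactly `α > -1 / n`. -/
lemma entropy_integral_lt_top {n : ℕ} (hn : 1 ≤ n) {α : ℝ} (hα : -(1 / (n : ℝ)) < α) (hα0 : α < 0)
    {ϱ : Measure (E n)} (hϱ : ϱ ∈ P₁ n) :
    ∫⁻ x, ϱ.rnDeriv volume x ^ (1 / (1 - α)) < ⊤ := by
  have hn' : (0 : ℝ) < n := by exact_mod_cast hn
  obtain ⟨hp, hm⟩ := hϱ
  have h1 : (0 : ℝ) < 1 - α := by linarith
  have h2 : 1 - 1 / (1 - α) = -α / (1 - α) := by field_simp; ring
  refine lintegral_rpow_lt_top (by positivity) ?_ ?_ (Measure.measurable_rnDeriv _ _) ?_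
  · rw [div_lt_one h1]; linarith
  · rw [h2]
    have : 1 / (1 - α) / (-α / (1 - α)) = 1 / -α := by field_simp
    rw [this, lt_div_iff₀ (by linarith)]
    have := mul_lt_mul_of_pos_left hα hn'
    rw [mul_neg, mul_one_div_cancel hn'.ne'] at this
    linarith
  · calc ∫⁻ x, ϱ.rnDeriv volume x * (1 + ‖x‖ₑ) =
        ∫⁻ x, (1 + ‖x‖ₑ) ∂(volume.withDensity (ϱ.rnDeriv volume)) := by
          rw [lintegral_withDensity_eq_lintegral_mul _ (Measure.measurable_rnDeriv _ _)
            (by fun_prop)]; rfl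
      _ ≤ ∫⁻ x, (1 + ‖x‖ₑ) ∂ϱ := lintegral_mono' (Measure.withDensity_rnDeriv_le _ _) le_rfl
      _ < ⊤ := by
        rw [lintegral_add_left measurable_const]
        exact ENNReal.add_lt_top.2 ⟨by simp, hm⟩

/-- The product plan is a competitor with integrable inner product. -/
lemma maxCorrelation_ne_bot {n : ℕ} {ϱ μ : Measure (E n)} (hϱ : ϱ ∈ P₁ n) (hμ : μ ∈ P₁ n) :
    maxCorrelation ϱ μ ≠ ⊥ := by
  obtain ⟨hp, hm⟩ := hϱ
  obtain ⟨hp', hm'⟩ := hμ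
  have hfin : ∫⁻ z : E n × E n, ‖z.1‖ₑ * ‖z.2‖ₑ ∂(ϱ.prod μ) < ⊤ := by
    rw [lintegral_prod_mul (by fun_prop) (by fun_prop)]
    exact ENNReal.mul_lt_top hm hm'
  have hle : extIntegral (ϱ.prod μ) (fun z : E n × E n => inner ℝ z.1 z.2) ≤
      maxCorrelation ϱ μ :=
    le_iSup₂ (f := fun π (_ : π ∈ transferencePlans ϱ μ) =>
      extIntegral π fun z : E n × E n => inner ℝ z.1 z.2) (ϱ.prod μ) ⟨by simp, by simp⟩
  refine (lt_of_lt_of_le ?_ hle).ne'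
  have hb : ∫⁻ z : E n × E n, ENNReal.ofReal (-inner ℝ z.1 z.2) ∂(ϱ.prod μ) ≠ ⊤ := by
    refine (lt_of_le_of_lt (lintegral_mono fun z => ?_) hfin).ne
    rw [← ofReal_norm, ← ofReal_norm, ← ENNReal.ofReal_mul (norm_nonneg _)]
    exact ENNReal.ofReal_le_ofReal ((neg_le_abs _).trans (abs_real_inner_le_norm _ _))
  unfold extIntegral
  rw [bot_lt_iff_ne_bot, sub_eq_add_neg, Ne, EReal.add_eq_bot_iff]
  simp [hb]

lemma maxCorrelation_dirac_le {n : ℕ} (μ : Measure (E n)) :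
    maxCorrelation (Measure.dirac 0) μ ≤ 0 := by
  refine iSup₂_le fun π hπ => ?_
  have h : ∀ᵐ z ∂π, z.1 = 0 := by
    refine ae_of_ae_map (p := fun x => x = 0) measurable_fst.aemeasurable ?_
    rw [hπ.1]
    simp
  unfold extIntegral
  rw [lintegral_congr_ae (g := fun _ => 0) (h.mono fun z hz => by simp [hz])]
  simp [EReal.coe_ennreal_nonneg]

/-- Since `-α > 0`, an infinite correlation would make the objective `+∞`, whereas the Dirac mass at
the origin has a finite one. -/
lemma maxCorrelation_ne_top {n : ℕ} (hn : 1 ≤ n) {α : ℝ} (hα : -(1 / (n : ℝ)) < α) (hα0 : α < 0)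
    {ϱ₀ μ : Measure (E n)} (hμ : μ ∈ P₁ n) (hsol : IsSolution α μ ϱ₀) :
    maxCorrelation ϱ₀ μ ≠ ⊤ := by
  intro htop
  have hd : Measure.dirac (0 : E n) ∈ P₁ n := ⟨inferInstance, by simp⟩
  have hA := entropy_integral_lt_top hn hα hα0 hsol.1
  have hAd := entropy_integral_lt_top hn hα hα0 hd
  have h := hsol.2 hd
  simp only [mem_ofPred_eq, objective, entropy, htop] at h
  have hdT : maxCorrelation (Measure.dirac (0 : E n)) μ ≠ ⊤ :=
    ((maxCorrelation_dirac_le μ).trans_lt (by simp)).ne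
  have hdB := maxCorrelation_ne_bot hd hμ
  generalize maxCorrelation (Measure.dirac (0 : E n)) μ = T at *
  generalize ∫⁻ x, ϱ₀.rnDeriv volume x ^ (1 / (1 - α)) = A at *
  generalize ∫⁻ x, (Measure.dirac (0 : E n)).rnDeriv volume x ^ (1 / (1 - α)) = B at *
  lift T to ℝ using ⟨hdT, hdB⟩
  lift A to NNReal using hA.ne
  lift B to NNReal using hAd.ne
  rw [EReal.coe_mul_top_of_neg hα0] at h
  have e1 : ((1 - α : ℝ) : EReal) * -((A : ℝ≥0∞) : EReal) - ⊥ = ⊤ :=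
    EReal.coe_sub_bot ((1 - α) * -(A : ℝ))
  rw [e1] at h
  exact absurd (top_le_iff.1 h) (EReal.coe_ne_top ((1 - α) * -(B : ℝ) - α * T))

/-! ### Optimality under displacement of mass -/

/-- First-order optimality condition. -/
lemma IsSolution.entropy_le {n : ℕ} (hn : 1 ≤ n) {α : ℝ} (hα : -(1 / (n : ℝ)) < α) (hα0 : α < 0)
    {ϱ₀ ϱ' μ : Measure (E n)} (hμ : μ ∈ P₁ n) (hsol : IsSolution α μ ϱ₀)
    (γ : Measure (E n × E n)) [IsProbabilityMeasure γ] (h1 : γ.map Prod.fst = ϱ')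
    (h2 : γ.map Prod.snd = ϱ₀) {ε : ℝ} (hγ : ∀ᵐ z ∂γ, ‖z.1 - z.2‖ ≤ ε)
    (M : ℝ≥0∞) (hM : M ≠ ⊤) :
    ENNReal.ofReal (1 - α) * ∫⁻ x, ϱ'.rnDeriv volume x ^ (1 / (1 - α)) ≤
      ENNReal.ofReal (1 - α) * (∫⁻ x, ϱ₀.rnDeriv volume x ^ (1 / (1 - α))) +
        ENNReal.ofReal (-α) * (ENNReal.ofReal ε * (M * γ {z | z.1 ≠ z.2} +
          ∫⁻ y in {y | M < ‖y‖ₑ}, ‖y‖ₑ ∂μ)) := by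
  have := hμ.1
  have hϱ' : ϱ' ∈ P₁ n := by
    refine ⟨h1 ▸ Measure.isProbabilityMeasure_map measurable_fst.aemeasurable, ?_⟩
    rw [← h1, lintegral_map (by fun_prop) measurable_fst]
    calc ∫⁻ z, ‖z.1‖ₑ ∂γ ≤ ∫⁻ z, (‖z.2‖ₑ + ENNReal.ofReal ε) ∂γ := by
          refine lintegral_mono_ae (hγ.mono fun z hz => ?_)
          rw [← ofReal_norm, ← ofReal_norm]
          refine le_trans (ENNReal.ofReal_le_ofReal ?_) ENNReal.ofReal_add_le
          have := norm_sub_norm_le z.1 z.2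
          linarith
      _ = ∫⁻ x, ‖x‖ₑ ∂ϱ₀ + ENNReal.ofReal ε := by
          rw [lintegral_add_right _ measurable_const, ← h2,
            lintegral_map (by fun_prop) measurable_snd]
          simp
      _ < ⊤ := ENNReal.add_lt_top.2 ⟨hsol.1.2, ENNReal.ofReal_lt_top⟩
  have hT := maxCorrelation_le_add γ h1 h2 hγ M hM hμ.2
  have herr : ENNReal.ofReal ε * (M * γ {z | z.1 ≠ z.2} +
      ∫⁻ y in {y | M < ‖y‖ₑ}, ‖y‖ₑ ∂μ) ≠ ⊤ :=
    ENNReal.mul_ne_top ENNReal.ofReal_ne_top (ENNReal.add_ne_top.2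
      ⟨ENNReal.mul_ne_top hM (measure_ne_top _ _),
        ne_top_of_le_ne_top hμ.2.ne (setLIntegral_le_lintegral _ _)⟩)
  have hA := entropy_integral_lt_top hn hα hα0 hsol.1
  have hB := entropy_integral_lt_top hn hα hα0 hϱ'
  have hT0 := maxCorrelation_ne_top hn hα hα0 hμ hsol
  have hT0' := maxCorrelation_ne_bot hsol.1 hμ
  have hT' := maxCorrelation_ne_bot hϱ' hμ
  have h := hsol.2 hϱ'
  simp only [mem_ofPred_eq, objective, entropy] at h
  -- The entropies, the error and the correlation of `ϱ₀` are finite. The stability bound then makes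
  -- `T'` finite too, and the comparison of objectives becomes one of real numbers.
  generalize ENNReal.ofReal ε * (M * γ {z | z.1 ≠ z.2} +
      ∫⁻ y in {y | M < ‖y‖ₑ}, ‖y‖ₑ ∂μ) = e at *
  generalize ∫⁻ x, ϱ₀.rnDeriv volume x ^ (1 / (1 - α)) = A at *
  generalize ∫⁻ x, ϱ'.rnDeriv volume x ^ (1 / (1 - α)) = B at *
  generalize maxCorrelation ϱ₀ μ = T at *
  generalize maxCorrelation ϱ' μ = T' at *
  lift A to NNReal using hA.ne
  lift B to NNReal using hB.ne
  lift e to NNReal using herr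
  lift T to ℝ using ⟨hT0, hT0'⟩
  have hTe : T' ≤ ((T + e : ℝ) : EReal) := hT
  lift T' to ℝ using ⟨(hTe.trans_lt (EReal.coe_lt_top _)).ne, hT'⟩
  have h' : (1 - α) * -(A : ℝ) - α * T ≤ (1 - α) * -(B : ℝ) - α * T' := EReal.coe_le_coe_iff.1 h
  have hTe' : T' ≤ T + e := EReal.coe_le_coe_iff.1 hTe
  rw [ENNReal.ofReal, ENNReal.ofReal]
  norm_cast
  rw [← NNReal.coe_le_coe]
  push_cast
  rw [Real.coe_toNNReal _ (by linarith), Real.coe_toNNReal _ (by linarith)]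
  nlinarith

/-! ### The absolutely continuous part does not vanish -/

/-- A density `f ≤ C` satisfies `f ≤ C ^ (1 - p) f ^ p`, and `f` has integral one. -/
lemma one_le_rpow_mul_lintegral_rnDeriv_rpow {X : Type*} [MeasurableSpace X] {m ϱ : Measure X}
    [SigmaFinite m] [IsProbabilityMeasure ϱ] {C : ℝ≥0∞} (h : ϱ ≤ C • m) {p : ℝ} (hp : 0 ≤ p)
    (hp1 : p < 1) : 1 ≤ C ^ (1 - p) * ∫⁻ x, ϱ.rnDeriv m x ^ p ∂m := by
  have hac : ϱ ≪ m := (Measure.absolutelyContinuous_of_le h).trans Measure.smul_absolutelyContinuous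
  have hle : ϱ.rnDeriv m ≤ᵐ[m] fun _ => C := by
    refine ae_le_of_forall_setLIntegral_le_of_sigmaFinite (Measure.measurable_rnDeriv _ _)
      fun s hs _ => ?_
    rw [Measure.setLIntegral_rnDeriv hac, setLIntegral_const]
    exact h s
  calc (1 : ℝ≥0∞) = ∫⁻ x, ϱ.rnDeriv m x ∂m := by
        rw [Measure.lintegral_rnDeriv hac, measure_univ]
    _ ≤ ∫⁻ x, C ^ (1 - p) * ϱ.rnDeriv m x ^ p ∂m := by
        refine lintegral_mono_ae (hle.mono fun x hx => ?_)
        calc ϱ.rnDeriv m x = ϱ.rnDeriv m x ^ (1 - p) * ϱ.rnDeriv m x ^ p := by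
              rw [← ENNReal.rpow_add_of_nonneg _ _ (by linarith) hp]; simp
          _ ≤ _ := by gcongr
    _ = _ := lintegral_const_mul _ ((Measure.measurable_rnDeriv _ _).pow_const _)

/-- Smoothing by a uniform distribution on a small ball. -/
lemma exists_coupling_le_smul_volume {n : ℕ} (ϱ : Measure (E n)) [IsProbabilityMeasure ϱ] {r : ℝ}
    (hr : 0 < r) : ∃ γ : Measure (E n × E n), IsProbabilityMeasure γ ∧ γ.map Prod.snd = ϱ ∧
      (∀ᵐ z ∂γ, ‖z.1 - z.2‖ ≤ r) ∧
      γ.map Prod.fst ≤ (volume (Metric.ball (0 : E n) r))⁻¹ • volume := by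
  set B := Metric.ball (0 : E n) r
  have hB0 : volume B ≠ 0 := (Metric.measure_ball_pos volume 0 hr).ne'
  have hBt : volume B ≠ ⊤ := measure_ball_lt_top.ne
  set u : Measure (E n) := (volume B)⁻¹ • volume.restrict B with hu
  have hup : IsProbabilityMeasure u := ⟨by simp [u, ENNReal.inv_mul_cancel hB0 hBt]⟩
  have hT : Measurable fun z : E n × E n => (z.1 + z.2, z.1) := by fun_prop
  refine ⟨(ϱ.prod u).map fun z => (z.1 + z.2, z.1),
    Measure.isProbabilityMeasure_map hT.aemeasurable, ?_, ?_, ?_⟩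
  · rw [Measure.map_map measurable_snd hT]
    exact (measurePreserving_fst (μ := ϱ) (ν := u)).map_eq
  · rw [ae_map_iff hT.aemeasurable (measurableSet_le (by fun_prop) measurable_const)]
    have h2 : ∀ᵐ y ∂u, ‖y‖ ≤ r := by
      refine Measure.ae_smul_measure ?_ _
      refine (ae_restrict_mem Metric.isOpen_ball.measurableSet).mono fun y hy => ?_
      simpa using (Metric.mem_ball.1 hy).le
    have h3 : ∀ᵐ z ∂(ϱ.prod u), ‖z.2‖ ≤ r := by
      refine ae_of_ae_map (p := fun y => ‖y‖ ≤ r) measurable_snd.aemeasurable ?_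
      rwa [(measurePreserving_snd (μ := ϱ) (ν := u)).map_eq]
    exact h3.mono fun z hz => by simpa using hz
  · rw [Measure.map_map measurable_fst hT]
    refine Measure.le_iff.2 fun s hs => ?_
    have hadd : Measurable (Prod.fst ∘ fun z : E n × E n => (z.1 + z.2, z.1)) := by fun_prop
    rw [Measure.map_apply hadd hs, Measure.prod_apply (hadd hs)]
    calc ∫⁻ x, u (Prod.mk x ⁻¹' ((Prod.fst ∘ fun z : E n × E n => (z.1 + z.2, z.1)) ⁻¹' s)) ∂ϱ
        ≤ ∫⁻ _, (volume B)⁻¹ * volume s ∂ϱ := by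
          refine lintegral_mono fun x => ?_
          rw [hu, Measure.smul_apply, smul_eq_mul]
          refine mul_le_mul' le_rfl ((Measure.restrict_le_self _).trans (le_of_eq ?_))
          exact measure_preimage_add volume x s
      _ = _ := by simp

/-- Smoothing at scale `r` would raise the integral from zero to at least order `r ^ (n q)` with `q
= -α / (1 - α)`, at a correlation cost `O(r)`. Since `n q < 1`, small `r` contradicts minimality. -/
lemma IsSolution.lintegral_rnDeriv_rpow_ne_zero {n : ℕ} (hn : 1 ≤ n) {α : ℝ}
    (hα : -(1 / (n : ℝ)) < α) (hα0 : α < 0) {ϱ₀ μ : Measure (E n)} (hμ : μ ∈ P₁ n)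
    (hsol : IsSolution α μ ϱ₀) :
    ∫⁻ x, ϱ₀.rnDeriv volume x ^ (1 / (1 - α)) ≠ 0 := by
  intro h0
  have := hsol.1.1
  have hn' : (0 : ℝ) < n := by exact_mod_cast hn
  have h1 : (0 : ℝ) < 1 - α := by linarith
  have hnα : n * -α < 1 := by
    have := mul_lt_mul_of_pos_left hα hn'
    rw [mul_neg, mul_one_div_cancel hn'.ne'] at this
    linarith
  set q : ℝ := 1 - 1 / (1 - α) with hq
  have hq' : q = -α / (1 - α) := by rw [hq]; field_simp; ring
  have hq0 : 0 < q := by rw [hq']; exact div_pos (by linarith) h1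
  have hnq : n * q < 1 := by
    rw [hq', ← mul_div_assoc, div_lt_one h1]; linarith
  set v := volume (Metric.ball (0 : E n) 1) with hv
  have hv0 : v ≠ 0 := (Metric.measure_ball_pos volume 0 one_pos).ne'
  set I := ∫⁻ y, ‖y‖ₑ ∂μ
  have hIt : I ≠ ⊤ := hμ.2.ne
  have key : ∀ r : ℝ, 0 < r → ENNReal.ofReal (1 - α) ≤
      (v⁻¹ ^ q * ENNReal.ofReal (-α) * I) * ENNReal.ofReal (r ^ (1 - n * q)) := by
    intro r hr
    obtain ⟨γ, hγp, hγ2, hγ, hγ1⟩ := exists_coupling_le_smul_volume ϱ₀ hr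
    have hp' := Measure.isProbabilityMeasure_map (μ := γ) measurable_fst.aemeasurable
    have hA := one_le_rpow_mul_lintegral_rnDeriv_rpow hγ1 (p := 1 / (1 - α)) (by positivity)
      (by linarith)
    -- At threshold `M = 0` the tail is bounded by the first moment of `μ`, which suffices here.
    have hopt := hsol.entropy_le hn hα hα0 hμ γ rfl hγ2 hγ 0 (by simp)
    rw [h0, mul_zero, zero_add, zero_mul, zero_add] at hopt
    have hvol : volume (Metric.ball (0 : E n) r) = ENNReal.ofReal (r ^ n) * v := by
      rw [Measure.addHaar_ball_of_pos volume 0 hr]; simp [v]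
    have hrn : ENNReal.ofReal (r ^ n) ≠ 0 := by simpa using pow_pos hr n
    rw [hvol, ENNReal.mul_inv (Or.inl hrn) (Or.inr hv0), ENNReal.mul_rpow_of_nonneg _ _ hq0.le]
      at hA
    have hpow : ENNReal.ofReal (r ^ (1 - n * q)) =
        (ENNReal.ofReal (r ^ n))⁻¹ ^ q * ENNReal.ofReal r := by
      rw [← ENNReal.ofReal_inv_of_pos (by positivity), ENNReal.ofReal_rpow_of_pos (by positivity),
        ← ENNReal.ofReal_mul (by positivity)]
      congr 1
      rw [Real.rpow_sub hr, Real.rpow_one, Real.rpow_mul hr.le, Real.rpow_natCast,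
        Real.inv_rpow (by positivity)]
      field_simp
    set A := ∫⁻ x, (γ.map Prod.fst).rnDeriv volume x ^ (1 / (1 - α))
    calc ENNReal.ofReal (1 - α) = ENNReal.ofReal (1 - α) * 1 := (mul_one _).symm
      _ ≤ ENNReal.ofReal (1 - α) * ((ENNReal.ofReal (r ^ n))⁻¹ ^ q * v⁻¹ ^ q * A) :=
        mul_le_mul' le_rfl hA
      _ = ((ENNReal.ofReal (r ^ n))⁻¹ ^ q * v⁻¹ ^ q) * (ENNReal.ofReal (1 - α) * A) := by ring
      _ ≤ ((ENNReal.ofReal (r ^ n))⁻¹ ^ q * v⁻¹ ^ q) * (ENNReal.ofReal (-α) *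
          (ENNReal.ofReal r * I)) :=
        mul_le_mul' le_rfl (hopt.trans (mul_le_mul' le_rfl (mul_le_mul' le_rfl
          (setLIntegral_le_lintegral _ _))))
      _ = _ := by rw [hpow]; ring
  have hK : v⁻¹ ^ q * ENNReal.ofReal (-α) * I ≠ ⊤ :=
    ENNReal.mul_ne_top (ENNReal.mul_ne_top
      (ENNReal.rpow_ne_top_of_nonneg hq0.le (ENNReal.inv_ne_top.2 hv0)) ENNReal.ofReal_ne_top) hIt
  have hlim : Tendsto (fun r : ℝ => (v⁻¹ ^ q * ENNReal.ofReal (-α) * I) *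
      ENNReal.ofReal (r ^ (1 - n * q))) (𝓝[>] 0) (𝓝 0) := by
    have h2 : Tendsto (fun r : ℝ => r ^ (1 - n * q)) (𝓝[>] 0) (𝓝 0) := by
      have := (Real.continuousAt_rpow_const 0 (1 - n * q) (Or.inr (by linarith))).tendsto
      rw [Real.zero_rpow (by linarith)] at this
      exact this.mono_left nhdsWithin_le_nhds
    have h3 := ENNReal.Tendsto.const_mul (ENNReal.tendsto_ofReal h2)
      (a := v⁻¹ ^ q * ENNReal.ofReal (-α) * I) (Or.inr hK)
    simpa using h3
  have hfin := ge_of_tendsto hlim (eventually_nhdsWithin_of_forall key)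
  have : ENNReal.ofReal (1 - α) ≤ 0 := hfin
  rw [nonpos_iff_eq_zero, ENNReal.ofReal_eq_zero] at this
  linarith

/-! ### Moving half of the mass of a set -/

lemma map_add_right_withDensity {n : ℕ} {f : E n → ℝ≥0∞} (v : E n) :
    (volume.withDensity f).map (· + v) = volume.withDensity fun x => f (x - v) := by
  ext s hs
  rw [Measure.map_apply (measurable_add_const v) hs,
    withDensity_apply _ (measurable_add_const v hs), withDensity_apply _ hs]
  simpa using (measurePreserving_add_right volume v).setLIntegral_comp_preimage_emb
    (measurableEmbedding_addRight v) (fun x => f (x - v)) s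

/-- Two separate copies of `ρ / 2` contribute `2 (ρ / 2) ^ p = 2 ^ (1 - p) ρ ^ p`, so `κ = 2 ^ (1 -
p) - 1` is the relative gain from splitting. -/
lemma exists_one_add_eq_two_mul_rpow {p : ℝ} (hp : p < 1) :
    ∃ κ : ℝ≥0∞, κ ≠ 0 ∧ 1 + κ = 2 * 2⁻¹ ^ p := by
  have h : (1 : ℝ≥0∞) < 2 * 2⁻¹ ^ p := by
    have e : (2 : ℝ≥0∞) * 2⁻¹ ^ p = 2 ^ (1 - p) := by
      rw [ENNReal.inv_rpow, ← ENNReal.rpow_neg, sub_eq_add_neg,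
        ENNReal.rpow_add _ _ (by simp) (by simp), ENNReal.rpow_one]
    rw [e]
    exact ENNReal.one_lt_rpow (by norm_num) (by linarith)
  exact ⟨2 * 2⁻¹ ^ p - 1, (tsub_pos_of_lt h).ne', add_tsub_cancel_of_le h.le⟩

/-- Optimality condition for moving half of the mass in `L` by the vector `v`. -/
lemma IsSolution.lintegral_rpow_le {n : ℕ} (hn : 1 ≤ n) {α : ℝ}
    (hα : -(1 / (n : ℝ)) < α) (hα0 : α < 0) {ϱ₀ ϱs μ : Measure (E n)} (hμ : μ ∈ P₁ n)
    (hsol : IsSolution α μ ϱ₀) {ρ : E n → ℝ≥0∞} (hρ : Measurable ρ)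
    (hs : ϱs.MutuallySingular volume) (hdec : ϱ₀ = volume.withDensity ρ + ϱs)
    {L : Set (E n)} (hL : MeasurableSet L) {v : E n} (hLv : ∀ x ∈ L, x + v ∉ L)
    (hρv : ∀ x ∈ L, ρ (x + v) = 0) {κ : ℝ≥0∞} (hκ : 1 + κ = 2 * 2⁻¹ ^ (1 / (1 - α)))
    (M : ℝ≥0∞) (hM : M ≠ ⊤) :
    ENNReal.ofReal (1 - α) * (κ * ∫⁻ x in L, ρ x ^ (1 / (1 - α))) ≤
      ENNReal.ofReal (-α) * (ENNReal.ofReal ‖v‖ * (M * (∫⁻ x in L, ρ x) +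
        ∫⁻ y in {y | M < ‖y‖ₑ}, ‖y‖ₑ ∂μ)) := by
  have := hsol.1.1
  have hp : 0 < 1 / (1 - α) := one_div_pos.2 (by linarith)
  set p := 1 / (1 - α) with hp_def
  -- With `f` the part outside `L` and `g` half of the part inside, `ρ = f + g + g`. The competitor
  -- has density `f + g + g(· - v)` and keeps the singular part.
  set f : E n → ℝ≥0∞ := Lᶜ.indicator ρ with hf
  set g : E n → ℝ≥0∞ := L.indicator fun x => 2⁻¹ * ρ x with hg
  have hfm : Measurable f := hρ.indicator hL.compl
  have hgm : Measurable g := (hρ.const_mul _).indicator hL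
  have hgvm : Measurable fun x => g (x - v) := hgm.comp (measurable_sub_const v)
  have hsum : ρ = f + g + g := by
    ext x
    by_cases hx : x ∈ L
    · simp [hf, hg, hx, ← add_mul, ENNReal.inv_two_add_inv_two]
    · simp [hf, hg, hx]
  set σ₁ := volume.withDensity (f + g) + ϱs with hσ₁
  set σ₂ := volume.withDensity g with hσ₂
  have hσ : ϱ₀ = σ₁ + σ₂ := by
    rw [hdec, hsum, withDensity_add_right _ hgm, hσ₁, hσ₂]
    abel
  have hm1 : Measurable fun x : E n => (x, x) := by fun_prop
  have hm2 : Measurable fun x : E n => (x + v, x) := by fun_prop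
  set γ := σ₁.map (fun x => (x, x)) + σ₂.map (fun x => (x + v, x)) with hγ
  have hγ2 : γ.map Prod.snd = ϱ₀ := by
    rw [hγ, Measure.map_add _ _ measurable_snd, Measure.map_map measurable_snd hm1,
      Measure.map_map measurable_snd hm2, hσ]
    simp [Function.comp_def]
  have hγp : IsProbabilityMeasure γ := by
    have : IsProbabilityMeasure (γ.map Prod.snd) := by rw [hγ2]; infer_instance
    exact Measure.isProbabilityMeasure_of_map Prod.snd
  have hγ1 : γ.map Prod.fst = ϱs + volume.withDensity (f + g + fun x => g (x - v)) := by
    rw [hγ, Measure.map_add _ _ measurable_fst, Measure.map_map measurable_fst hm1,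
      Measure.map_map measurable_fst hm2, withDensity_add_right _ hgvm,
      ← map_add_right_withDensity]
    simp only [Function.comp_def, Measure.map_id', hσ₁]
    abel
  have hγd : ∀ᵐ z ∂γ, ‖z.1 - z.2‖ ≤ ‖v‖ := by
    have hms : MeasurableSet {z : E n × E n | ‖z.1 - z.2‖ ≤ ‖v‖} :=
      measurableSet_le (by fun_prop) measurable_const
    rw [hγ, ae_add_measure_iff, ae_map_iff hm1.aemeasurable hms, ae_map_iff hm2.aemeasurable hms]
    simp
  have hD : MeasurableSet {z : E n × E n | z.1 ≠ z.2} :=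
    (measurableSet_eq_fun measurable_fst measurable_snd).compl
  have hγD : γ {z | z.1 ≠ z.2} ≤ ∫⁻ x in L, ρ x := by
    rw [hγ, Measure.add_apply, Measure.map_apply hm1 hD, Measure.map_apply hm2 hD]
    simp only [preimage_ofPred_eq, ne_eq, not_true_eq_false]
    calc _ ≤ σ₂ univ := by simpa using measure_mono (subset_univ _)
      _ = ∫⁻ x in L, 2⁻¹ * ρ x := by
        rw [hσ₂, withDensity_apply _ MeasurableSet.univ, Measure.restrict_univ, hg,
          lintegral_indicator hL]
      _ ≤ _ := lintegral_mono fun x => mul_le_of_le_one_left' (by simp)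
  have hopt := hsol.entropy_le hn hα hα0 hμ γ hγ1 hγ2 hγd M hM
  have hd0 : ρ =ᵐ[volume] ϱ₀.rnDeriv volume :=
    Measure.eq_rnDeriv hρ hs (by rw [hdec, add_comm])
  have hd1 : (f + g + fun x => g (x - v)) =ᵐ[volume]
      (ϱs + volume.withDensity (f + g + fun x => g (x - v))).rnDeriv volume :=
    Measure.eq_rnDeriv ((hfm.add hgm).add hgvm) hs rfl
  have hA := entropy_integral_lt_top hn hα hα0 hsol.1
  have hI0 : ∫⁻ x, ϱ₀.rnDeriv volume x ^ p = ∫⁻ x, ρ x ^ p :=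
    lintegral_congr_ae (hd0.mono fun x hx => by simp only [hx])
  have hI1 : ∫⁻ x, (ϱs + volume.withDensity (f + g + fun x => g (x - v))).rnDeriv volume x ^ p =
      ∫⁻ x, (f + g + fun x => g (x - v)) x ^ p :=
    lintegral_congr_ae (hd1.mono fun x hx => by simp only [hx])
  rw [← hp_def, hI0] at hA
  rw [← hp_def, hI0, hI1] at hopt
  have hG : ∫⁻ x, g x ^ p = 2⁻¹ ^ p * ∫⁻ x in L, ρ x ^ p := by
    rw [← lintegral_const_mul _ (by fun_prop), ← lintegral_indicator hL]
    congr 1; ext x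
    by_cases hx : x ∈ L
    · simp [hg, hx, ENNReal.mul_rpow_of_nonneg _ _ hp.le]
    · simp [hg, hx, hp]
  have hF : ∫⁻ x, f x ^ p = ∫⁻ x in Lᶜ, ρ x ^ p := by
    rw [← lintegral_indicator hL.compl]
    congr 1; ext x
    by_cases hx : x ∈ L
    · simp [hf, hx, hp]
    · simp [hf, hx]
  have hgain : (∫⁻ x, ρ x ^ p) + κ * ∫⁻ x in L, ρ x ^ p ≤
      ∫⁻ x, (f + g + fun x => g (x - v)) x ^ p := by
    calc (∫⁻ x, ρ x ^ p) + κ * ∫⁻ x in L, ρ x ^ p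
        = (∫⁻ x in Lᶜ, ρ x ^ p) + (1 + κ) * ∫⁻ x in L, ρ x ^ p := by
          rw [← lintegral_add_compl _ hL, add_mul, one_mul]; abel
      _ = ∫⁻ x, (f x ^ p + g x ^ p + g (x - v) ^ p) := by
          rw [lintegral_add_right _ (by fun_prop), lintegral_add_right _ (by fun_prop),
            lintegral_sub_right_eq_self (fun x => g x ^ p) v, hF, hG, hκ]
          ring
      _ ≤ _ := by
          refine lintegral_mono fun x => ?_
          simp only [Pi.add_apply]
          -- At most one of `f`, `g`, `g(· - v)` is nonzero at a given point: `hLv` separates the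
          -- two copies of `g`, and `hρv` makes `f` vanish on `L + v`. Hence the `p`-th power
          -- distributes over the sum.
          by_cases hx : x ∈ L
          · have h1 : x - v ∉ L := fun h => hLv _ h (by simpa using hx)
            simp [hf, hg, hx, h1, hp]
          · by_cases hxv : x - v ∈ L
            · have h2 : ρ x = 0 := by simpa using hρv _ hxv
              simp [hf, hg, hx, h2, hp]
            · simp [hf, hg, hx, hxv, hp]
  have h1 := (mul_le_mul' (le_refl (ENNReal.ofReal (1 - α))) hgain).trans hopt
  rw [mul_add] at h1
  have h2 := (ENNReal.add_le_add_iff_left (ENNReal.mul_ne_top ENNReal.ofReal_ne_top hA.ne)).1 h1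
  refine h2.trans ?_
  gcongr

/-! ### Packing, covering and Hausdorff measure -/

lemma card_mul_volume_le {n : ℕ} {L : Set (E n)} {c C t : ℝ} (N : Finset (E n))
    (hN : (N : Set (E n)).Pairwise fun x y => 2 * C * t < dist x y)
    (h : ∀ x ∈ N, ∃ y, Metric.ball y (c * t) ⊆ L ∩ Metric.ball x (C * t)) :
    N.card * volume (Metric.ball (0 : E n) (c * t)) ≤ volume L := by
  choose! y hy using h
  have hd : (N : Set (E n)).PairwiseDisjoint fun x => Metric.ball (y x) (c * t) := by
    intro a ha b hb hab
    refine Disjoint.mono ((hy a ha).trans inter_subset_right) ((hy b hb).trans inter_subset_right)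
      (Metric.ball_disjoint_ball ?_)
    linarith [hN ha hb hab]
  calc N.card * volume (Metric.ball (0 : E n) (c * t))
      = ∑ x ∈ N, volume (Metric.ball (y x) (c * t)) := by
        simp [Measure.addHaar_ball_center]
    _ = volume (⋃ x ∈ N, Metric.ball (y x) (c * t)) :=
        (measure_biUnion_finset hd fun _ _ => Metric.isOpen_ball.measurableSet).symm
    _ ≤ volume L := measure_mono (iUnion₂_subset fun x hx => (hy x hx).trans inter_subset_left)

/-- The volume bound makes the packing number finite, so a maximal `2Ct`-separated subset of `D`
exists. Maximality turns it into a cover. -/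
lemma exists_finset_cover {n : ℕ} {D L : Set (E n)} {c C t : ℝ} (hc : 0 < c) (hC : 0 < C)
    (ht : 0 < t) (hL : volume L ≠ ⊤)
    (h : ∀ x ∈ D, ∃ y, Metric.ball y (c * t) ⊆ L ∩ Metric.ball x (C * t)) :
    ∃ N : Finset (E n), D ⊆ ⋃ x ∈ N, Metric.closedBall x (2 * C * t) ∧
      N.card * volume (Metric.ball (0 : E n) (c * t)) ≤ volume L := by
  have hε : 0 ≤ 2 * C * t := by positivity
  set ε : NNReal := ⟨2 * C * t, hε⟩
  have hsep : ∀ S : Set (E n), Metric.IsSeparated (ε : ℝ≥0∞) S →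
      S.Pairwise fun x y => 2 * C * t < dist x y := by
    intro S hS x hx y hy hxy
    have : (ε : ℝ≥0∞) < edist x y := hS hx hy hxy
    rw [edist_nndist] at this
    exact_mod_cast (ENNReal.coe_lt_coe.1 this)
  have hv0 : volume (Metric.ball (0 : E n) (c * t)) ≠ 0 :=
    (Metric.measure_ball_pos volume 0 (by positivity)).ne'
  have hpack : Metric.packingNumber ε D ≠ ⊤ := by
    obtain ⟨m, hm⟩ := ENNReal.exists_nat_gt (ENNReal.div_ne_top hL hv0)
    have hle : Metric.packingNumber ε D ≤ m := by
      -- A separated set with more than `m` points contains one with exactly `m`, already too many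
      -- for the volume of `L`.
      refine iSup₂_le fun S hSD => iSup_le fun hS => ?_
      by_contra hlt
      obtain ⟨S', hS', hcard⟩ := Set.exists_subset_encard_eq (not_le.1 hlt).le
      have hfin : S'.Finite := Set.finite_of_encard_eq_coe hcard
      have hb := card_mul_volume_le (L := L) (c := c) (C := C) (t := t) hfin.toFinset
        (hsep _ (hS.subset (by simpa using hS'))) (fun x hx => h x (hSD (hS' (by simpa using hx))))
      rw [← Set.ncard_eq_toFinset_card _ hfin, Set.ncard, hcard, ENat.toNat_natCast] at hb
      exact absurd (ENNReal.le_div_iff_mul_le (Or.inl hv0) (Or.inr hL) |>.2 hb) (not_le.2 hm)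
    exact ne_top_of_le_ne_top (ENat.natCast_ne_top m) hle
  have hcov := Metric.isCover_maximalSeparatedSet hpack
  have hmfin : (Metric.maximalSeparatedSet ε D).Finite := by
    rw [← Set.encard_ne_top_iff, Metric.encard_maximalSeparatedSet hpack]; exact hpack
  refine ⟨hmfin.toFinset, ?_, card_mul_volume_le (C := C) _ (hsep _ ?_) fun x hx => h x ?_⟩
  · rw [Metric.isCover_iff_subset_iUnion_closedEBall] at hcov
    refine hcov.trans ?_
    simp only [Set.Finite.mem_toFinset]
    refine iUnion₂_mono fun x _ => ?_
    rw [Metric.closedEBall_coe]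
    rfl
  · simpa using Metric.isSeparated_maximalSeparatedSet
  · exact Metric.maximalSeparatedSet_subset (by simpa using hx)

/-- A set whose points all see balls of radius `c t` in `L t` at distance `O(t)` is
`𝓗ⁿ⁻¹`-null when `|L t| = o(t)`. -/
lemma hausdorffMeasure_eq_zero_of_volume_isLittleO {n : ℕ} (hn : 1 ≤ n) {D : Set (E n)}
    {L : ℝ → Set (E n)} {c C : ℝ} (hc : 0 < c) (hC : 0 < C)
    (h : ∀ᶠ t in 𝓝[>] (0 : ℝ), ∀ x ∈ D, ∃ y,
      Metric.ball y (c * t) ⊆ L t ∩ Metric.ball x (C * t))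
    (hL : Tendsto (fun t => volume (L t) / ENNReal.ofReal t) (𝓝[>] 0) (𝓝 0)) :
    μH[((n - 1 : ℕ) : ℝ)] D = 0 := by
  have hpos : ∀ᶠ t in 𝓝[>] (0 : ℝ), 0 < t := eventually_mem_nhdsWithin
  have hfin : ∀ᶠ t in 𝓝[>] (0 : ℝ), volume (L t) ≠ ⊤ := by
    filter_upwards [hL.eventually (gt_mem_nhds one_pos), hpos] with t ht ht0 htop
    rw [htop, ENNReal.top_div_of_ne_top ENNReal.ofReal_ne_top] at ht
    simp at ht
  have hex : ∀ᶠ t in 𝓝[>] (0 : ℝ), ∃ N : Finset (E n),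
      D ⊆ ⋃ x ∈ N, Metric.closedBall x (2 * C * t) ∧
      N.card * volume (Metric.ball (0 : E n) (c * t)) ≤ volume (L t) := by
    filter_upwards [h, hpos, hfin] with t h1 h2 h3
    exact exists_finset_cover hc hC h2 h3 h1
  obtain ⟨N, hN⟩ := hex.choice
  set v := volume (Metric.ball (0 : E n) 1) with hv
  have hv0 : v ≠ 0 := (Metric.measure_ball_pos volume 0 one_pos).ne'
  have hvt : v ≠ ⊤ := measure_ball_lt_top.ne
  -- Chosen so that a ball of radius `c t` has volume `K t ^ n`.
  set K : ℝ≥0∞ := ENNReal.ofReal c ^ n * v with hK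
  have hK0 : K ≠ 0 := mul_ne_zero (pow_ne_zero _ (by simpa using hc)) hv0
  have hKt : K ≠ ⊤ := ENNReal.mul_ne_top (ENNReal.pow_ne_top ENNReal.ofReal_ne_top) hvt
  have hlim0 : Tendsto (fun t : ℝ => ENNReal.ofReal (4 * C * t)) (𝓝[>] 0) (𝓝 0) := by
    have : Tendsto (fun t : ℝ => 4 * C * t) (𝓝 0) (𝓝 0) := by
      have : Continuous fun t : ℝ => 4 * C * t := by fun_prop
      simpa using this.tendsto 0
    simpa using ENNReal.tendsto_ofReal (this.mono_left nhdsWithin_le_nhds)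
  have hdiam : ∀ᶠ t in 𝓝[>] (0 : ℝ), ∀ x : N t,
      Metric.ediam (Metric.closedBall (x : E n) (2 * C * t)) ≤ ENNReal.ofReal (4 * C * t) := by
    filter_upwards [hpos] with t ht x
    rw [← Metric.closedEBall_ofReal (by positivity)]
    refine Metric.ediam_closedEBall_le.trans (le_of_eq ?_)
    rw [← ENNReal.ofReal_ofNat, ← ENNReal.ofReal_mul (by norm_num)]
    congr 1; ring
  have hmain := Measure.hausdorffMeasure_le_liminf_sum ((n - 1 : ℕ) : ℝ) D
    (l := 𝓝[>] (0 : ℝ)) (fun t => ENNReal.ofReal (4 * C * t)) hlim0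
    (fun t (x : N t) => Metric.closedBall (x : E n) (2 * C * t)) hdiam
    (by
      filter_upwards [hN] with t ht
      refine ht.1.trans ?_
      rw [iUnion_subtype])
  have hbound : Tendsto (fun t => ENNReal.ofReal (4 * C) ^ (n - 1) * K⁻¹ *
      (volume (L t) / ENNReal.ofReal t)) (𝓝[>] 0) (𝓝 0) := by
    have := ENNReal.Tendsto.const_mul hL (a := ENNReal.ofReal (4 * C) ^ (n - 1) * K⁻¹)
      (Or.inr (ENNReal.mul_ne_top (ENNReal.pow_ne_top ENNReal.ofReal_ne_top)
        (ENNReal.inv_ne_top.2 hK0)))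
    simpa using this
  have hsum : Tendsto (fun t => ∑ x : N t,
      Metric.ediam (Metric.closedBall (x : E n) (2 * C * t)) ^ ((n - 1 : ℕ) : ℝ))
      (𝓝[>] 0) (𝓝 0) := by
    refine tendsto_of_tendsto_of_tendsto_of_le_of_le' tendsto_const_nhds hbound
      (Eventually.of_forall fun _ => zero_le) ?_
    filter_upwards [hN, hdiam, hpos] with t ht hd ht0
    have ht0' : ENNReal.ofReal t ≠ 0 := by simpa using ht0
    have hvol : volume (Metric.ball (0 : E n) (c * t)) =
        ENNReal.ofReal t ^ (n - 1) * ENNReal.ofReal t * K := by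
      rw [Measure.addHaar_ball_of_pos volume 0 (by positivity), ← pow_succ, Nat.sub_add_cancel hn,
        ENNReal.ofReal_pow (by positivity), ENNReal.ofReal_mul hc.le, mul_pow]
      simp only [finrank_euclideanSpace, Fintype.card_fin, hK, hv]
      ring
    -- One factor `t` of `t ^ n` goes to the right side, leaving the power `n - 1` of the Hausdorff
    -- sum against `|L t| / t → 0`.
    have hcard : (N t).card * ENNReal.ofReal t ^ (n - 1) ≤
        K⁻¹ * (volume (L t) / ENNReal.ofReal t) := by
      rw [mul_comm K⁻¹, ← div_eq_mul_inv, ENNReal.le_div_iff_mul_le (Or.inl hK0) (Or.inl hKt),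
        ENNReal.le_div_iff_mul_le (Or.inl ht0') (Or.inl ENNReal.ofReal_ne_top)]
      refine le_trans (le_of_eq ?_) ht.2
      rw [hvol]; ring
    calc _ ≤ ∑ x : N t, ENNReal.ofReal (4 * C * t) ^ (n - 1) := by
          refine Finset.sum_le_sum fun x _ => ?_
          rw [ENNReal.rpow_natCast]
          exact pow_le_pow_left' (hd x) _
      _ = ENNReal.ofReal (4 * C) ^ (n - 1) * ((N t).card * ENNReal.ofReal t ^ (n - 1)) := by
          rw [ENNReal.ofReal_mul (by positivity), mul_pow]
          simp
          ring
      _ ≤ _ := by rw [mul_assoc]; exact mul_le_mul' le_rfl hcard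
  rw [hsum.liminf_eq] at hmain
  exact nonpos_iff_eq_zero.1 hmain

/-! ### The density as a function of `φ` -/

lemma one_sub_mul_top {α : ℝ} (hα : α < 0) : 1 - (α : EReal) * ⊤ = ⊤ := by
  rw [EReal.coe_mul_top_of_neg hα]
  exact EReal.coe_sub_bot 1

lemma monotone_one_sub_mul {α : ℝ} (hα : α < 0) : Monotone fun e : EReal => 1 - (α : EReal) * e := by
  intro a b hab
  refine EReal.sub_le_sub le_rfl ?_
  induction a with
  | bot => rw [EReal.coe_mul_bot_of_neg hα]; exact le_top
  | top => rw [top_le_iff.1 hab]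
  | coe a =>
    induction b with
    | bot => simp at hab
    | top => rw [EReal.coe_mul_top_of_neg hα]; exact bot_le
    | coe b =>
      have : a ≤ b := by exact_mod_cast hab
      exact_mod_cast mul_le_mul_of_nonpos_left this hα.le

lemma one_sub_mul_coe_lt_top (α c : ℝ) : 1 - (α : EReal) * c < ⊤ :=
  EReal.coe_lt_top (1 - α * c)

variable {n : ℕ} {φ : E n → EReal}

lemma measurable_density {α : ℝ} (hα : α < 0) (p : ℝ) (hφ : LowerSemicontinuous φ) :
    Measurable (density α p φ) := by
  have h := ((monotone_one_sub_mul hα).measurable.comp hφ.measurable)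
  exact h.ereal_toENNReal.pow_const p

lemma density_eq_zero_iff {α p : ℝ} (hα : α < 0) (hp : p < 0) {x : E n} :
    density α p φ x = 0 ↔ φ x = ⊤ := by
  unfold density
  rw [ENNReal.rpow_eq_zero_iff]
  constructor
  · rintro (⟨_, h⟩ | ⟨h, _⟩)
    · exact absurd h (not_lt.2 hp.le)
    · rw [EReal.toENNReal_eq_top_iff] at h
      by_contra hx
      have h1 := monotone_one_sub_mul hα (EReal.le_coe_toReal hx)
      simp only [h] at h1
      exact absurd h1 (not_le.2 (one_sub_mul_coe_lt_top α _))
  · intro h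
    rw [h, one_sub_mul_top hα]
    simp [hp]

/-- For negative `p` and `α` the density decreases in `φ`, so its value at level `c` is a lower
bound on the sublevel set. It turns the entropy gain into a bound on volume. -/
lemma exists_le_density {α p : ℝ} (hα : α < 0) (hp : p < 0) (c : ℝ) :
    ∃ δ : ℝ≥0∞, δ ≠ 0 ∧ ∀ x, φ x ≤ c → δ ≤ density α p φ x := by
  refine ⟨(1 - (α : EReal) * c).toENNReal ^ p, ?_, fun x hx => ?_⟩
  · rw [Ne, ENNReal.rpow_eq_zero_iff]
    rintro (⟨_, h⟩ | ⟨h, _⟩)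
    · linarith
    · exact (one_sub_mul_coe_lt_top α c).ne (EReal.toENNReal_eq_top_iff.1 h)
  · have hinv : ∀ a : ℝ≥0∞, a ^ p = a⁻¹ ^ (-p) := fun a => by
      rw [ENNReal.inv_rpow, ENNReal.rpow_neg, inv_inv]
    rw [density, hinv, hinv (1 - (α : EReal) * φ x).toENNReal]
    exact ENNReal.rpow_le_rpow (ENNReal.inv_le_inv.2
      (EReal.toENNReal_le_toENNReal (monotone_one_sub_mul hα hx))) (by linarith)

/-! ### Convex functions with values in `(-∞, +∞]` -/

lemma IsConvex.apply_le (hφ : IsConvex φ) {x y : E n} {a b : ℝ} (hx : φ x ≤ a) (hy : φ y ≤ b)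
    {s t : ℝ} (hs : 0 ≤ s) (ht : 0 ≤ t) (hst : s + t = 1) :
    φ (s • x + t • y) ≤ ((s * a + t * b : ℝ) : EReal) := by
  obtain rfl : t = 1 - s := by linarith
  refine (hφ.2 x y s hs (by linarith)).trans ?_
  push_cast
  exact add_le_add (mul_le_mul_of_nonneg_left hx (by exact_mod_cast hs))
    (mul_le_mul_of_nonneg_left hy (by exact_mod_cast ht))

lemma IsConvex.convex_sublevel (hφ : IsConvex φ) (c : ℝ) : Convex ℝ {x | φ x ≤ c} := by
  intro x hx y hy s t hs ht hst
  have := hφ.apply_le hx hy hs ht hst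
  rwa [← add_mul, hst, one_mul] at this

lemma IsConvex.convex_dom (hφ : IsConvex φ) : Convex ℝ {x | φ x ≠ ⊤} := by
  intro x hx y hy s t hs ht hst
  exact ((hφ.apply_le (EReal.le_coe_toReal hx) (EReal.le_coe_toReal hy) hs ht hst).trans_lt
    (EReal.coe_lt_top _)).ne

lemma IsConvex.continuousAt (hφ : IsConvex φ) {x : E n} (hx : x ∈ interior {x | φ x ≠ ⊤}) :
    ContinuousAt φ x := by
  have hsub : ∀ y ∈ interior {x | φ x ≠ ⊤}, φ y ≠ ⊤ := fun y hy => interior_subset hy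
  have hc : ConvexOn ℝ (interior {x | φ x ≠ ⊤}) fun x => (φ x).toReal := by
    refine ⟨hφ.convex_dom.interior, fun y hy z hz s t hs ht hst => ?_⟩
    have h := hφ.apply_le (EReal.le_coe_toReal (hsub y hy)) (EReal.le_coe_toReal (hsub z hz))
      hs ht hst
    exact EReal.toReal_le_toReal h (hφ.1 _) (EReal.coe_ne_top _)
  have hcont := (hc.continuousOn isOpen_interior).continuousAt (isOpen_interior.mem_nhds hx)
  have h2 : ContinuousAt (fun x => (((φ x).toReal : ℝ) : EReal)) x :=
    continuous_coe_real_ereal.continuousAt.comp hcont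
  refine h2.congr ?_
  filter_upwards [isOpen_interior.mem_nhds hx] with y hy
  exact EReal.coe_toReal (hsub y hy) (hφ.1 y)

/-- Provides the ball whose convex hull with a frontier point fills the boundary layer. -/
lemma IsConvex.exists_ball_subset_sublevel (hφ : IsConvex φ)
    (hne : (interior {x | φ x ≠ ⊤}).Nonempty) :
    ∃ (x₀ : E n) (r : ℝ) (j : ℕ), 0 < r ∧ Metric.ball x₀ r ⊆ {x | φ x ≤ (j : ℝ)} := by
  obtain ⟨x₀, hx₀⟩ := hne
  have hfin : φ x₀ ≠ ⊤ := interior_subset (s := {x | φ x ≠ ⊤}) hx₀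
  obtain ⟨j, hj⟩ := exists_nat_gt (φ x₀).toReal
  have hlt : φ x₀ < ((j : ℝ) : EReal) :=
    (EReal.le_coe_toReal hfin).trans_lt (EReal.coe_lt_coe_iff.2 hj)
  obtain ⟨r, hr, hb⟩ := Metric.eventually_nhds_iff_ball.1
    ((hφ.continuousAt hx₀).eventually (gt_mem_nhds hlt))
  exact ⟨x₀, r, j, hr, fun y hy => (hb y hy).le⟩

/-- At the value `⊤` continuity only asks for lower bounds. -/
lemma continuousAt_of_eq_top (hlsc : LowerSemicontinuous φ) {x : E n} (hx : φ x = ⊤) :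
    ContinuousAt φ x := by
  refine tendsto_order.2 ⟨fun a ha => hlsc x a ha, fun a ha => ?_⟩
  rw [hx] at ha
  exact absurd ha not_top_lt

/-- A convex set with interior points has the same interior as its closure, so a finite-valued point
off the frontier is interior to the domain, where `φ` is continuous. -/
lemma IsConvex.notContinuousAt_subset (hφ : IsConvex φ) (hlsc : LowerSemicontinuous φ)
    (hne : (interior {x | φ x ≠ ⊤}).Nonempty) :
    {x | ¬ ContinuousAt φ x} ⊆ {x | x ∈ frontier (closure {x | φ x ≠ ⊤}) ∧ φ x ≠ ⊤} := by
  intro x hx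
  have hx' : φ x ≠ ⊤ := fun h => hx (continuousAt_of_eq_top hlsc h)
  refine ⟨⟨subset_closure (subset_closure hx'), fun h => hx ?_⟩, hx'⟩
  rw [hφ.convex_dom.interior_closure_eq_interior_of_nonempty_interior hne] at h
  exact hφ.continuousAt h

/-! ### Geometry of the boundary layer -/

/-- Points of the frontier are not between an interior point and a point of the set. -/
lemma add_smul_sub_notMem {K : Set (E n)} (hK : Convex ℝ K) {x b : E n} (hx : x ∈ frontier K)
    (hb : b ∈ interior K) {s : ℝ} (hs : 0 < s) : x + s • (x - b) ∉ K := by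
  intro hy
  refine hx.2 (hK.openSegment_self_interior_subset_interior hy hb ?_)
  refine ⟨1 / (1 + s), s / (1 + s), by positivity, by positivity, by field_simp, ?_⟩
  have h : (1 : ℝ) + s ≠ 0 := by positivity
  calc (1 / (1 + s)) • (x + s • (x - b)) + (s / (1 + s)) • b
      = ((1 / (1 + s)) * (1 + s)) • x := by
        rw [div_eq_mul_inv s]; module
    _ = x := by rw [one_div_mul_cancel h, one_smul]

/-- The segment from `x` into the ball around `x₀` stays in `S`, while the shift along `z₀ - x₀`
carries its short initial piece across the frontier. The slack `r / 4` lets one direction serve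
every `x` near `z₀`. -/
lemma ball_subset_layer {K S : Set (E n)} (hK : Convex ℝ K) (hS : Convex ℝ S) (hSK : S ⊆ K)
    {x₀ x z₀ : E n} {r t : ℝ} (hb : Metric.ball x₀ r ⊆ S) (hx : x ∈ frontier K) (hxS : x ∈ S)
    (hxz : dist x z₀ ≤ r / 4) (ht : 0 < t) (ht1 : t < 1) :
    Metric.ball (x + (t / 2) • (x₀ - x)) (r / 4 * t) ⊆
      {z | z ∈ S ∧ z + t • (z₀ - x₀) ∉ K} ∩ Metric.ball x ((r + ‖z₀ - x₀‖) * t) := by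
  intro z hz
  -- Dilation from `x` by `2 / t` sends the small ball to the ball of radius `r / 2` around `x₀`.
  set b := x + (2 / t) • (z - x) with hb_def
  have hzb : z = x + (t / 2) • (b - x) := by
    have : (t / 2) * (2 / t) = 1 := by field_simp
    rw [hb_def, add_sub_cancel_left, smul_smul, this, one_smul, add_sub_cancel]
  have hbx : ‖b - x₀‖ < r / 2 := by
    have h1 : b - x₀ = (2 / t) • (z - (x + (t / 2) • (x₀ - x))) := by
      rw [hzb]
      have : (2 / t) * (t / 2) = 1 := by field_simp
      calc b - x₀ = (1 : ℝ) • (b - x₀) := (one_smul _ _).symm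
        _ = ((2 / t) * (t / 2)) • (b - x₀) := by rw [this]
        _ = _ := by module
    rw [h1, norm_smul, Real.norm_of_nonneg (by positivity)]
    rw [Metric.mem_ball, dist_eq_norm] at hz
    calc 2 / t * ‖z - (x + (t / 2) • (x₀ - x))‖ < 2 / t * (r / 4 * t) := by gcongr
      _ = r / 2 := by field_simp; ring
  have hr : 0 < r := by linarith [norm_nonneg (b - x₀)]
  have hbS : b ∈ S := hb (by rw [Metric.mem_ball, dist_eq_norm]; linarith)
  rw [dist_eq_norm] at hxz
  refine ⟨⟨?_, ?_⟩, ?_⟩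
  · have := hS hxS hbS (a := 1 - t / 2) (b := t / 2) (by linarith) (by linarith) (by ring)
    convert this using 1
    rw [hzb]; module
  -- Chosen so that `z + t (z₀ - x₀) = x + (t / 2) (x - b')`: the shifted point lies beyond `x` as
  -- seen from `b'`, which is within `r` of `x₀` and hence interior to `K`.
  · set b' := x₀ - (b - x₀) + (2 : ℝ) • (x - z₀) with hb'
    have hb'K : b' ∈ interior K := by
      refine interior_maximal (hb.trans hSK) Metric.isOpen_ball ?_
      rw [Metric.mem_ball, dist_eq_norm]
      calc ‖b' - x₀‖ = ‖(2 : ℝ) • (x - z₀) - (b - x₀)‖ := by rw [hb']; congr 1; abel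
        _ ≤ ‖(2 : ℝ) • (x - z₀)‖ + ‖b - x₀‖ := norm_sub_le _ _
        _ < r := by rw [norm_smul, Real.norm_of_nonneg (by norm_num)]; linarith
    have := add_smul_sub_notMem hK hx hb'K (s := t / 2) (by positivity)
    convert this using 2
    rw [hzb, hb']; module
  · rw [Metric.mem_ball, dist_eq_norm, hzb, add_sub_cancel_left, norm_smul,
      Real.norm_of_nonneg (by positivity)]
    have h1 : ‖b - x‖ ≤ ‖b - x₀‖ + ‖z₀ - x₀‖ + ‖x - z₀‖ := by
      calc ‖b - x‖ = ‖(b - x₀) - (z₀ - x₀) - (x - z₀)‖ := by congr 1; abel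
        _ ≤ _ := (norm_sub_le _ _).trans (add_le_add (norm_sub_le _ _) le_rfl)
    nlinarith [norm_nonneg (z₀ - x₀), norm_nonneg (b - x)]

/-! ### Mass and volume of thin layers -/

lemma tendsto_setLIntegral_lt_enorm {μ : Measure (E n)} (hμ : ∫⁻ y, ‖y‖ₑ ∂μ < ⊤) :
    Tendsto (fun k : ℕ => ∫⁻ y in {y | (k : ℝ≥0∞) < ‖y‖ₑ}, ‖y‖ₑ ∂μ) atTop (𝓝 0) := by
  have hm : ∀ k : ℕ, MeasurableSet {y : E n | (k : ℝ≥0∞) < ‖y‖ₑ} := fun k =>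
    measurableSet_lt measurable_const (by fun_prop)
  simp_rw [← lintegral_indicator (hm _)]
  rw [← lintegral_zero (μ := μ) (α := E n)]
  refine tendsto_lintegral_of_dominated_convergence (fun y => ‖y‖ₑ)
    (fun k => Measurable.indicator (by fun_prop) (hm k))
    (fun k => Eventually.of_forall fun y => indicator_le_self _ _ _) hμ.ne
    (Eventually.of_forall fun y => ?_)
  obtain ⟨m, hm⟩ := ENNReal.exists_nat_gt (enorm_ne_top (x := y))
  refine tendsto_const_nhds.congr' ?_
  filter_upwards [eventually_ge_atTop m] with k hk
  rw [indicator_of_notMem]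
  have : (m : ℝ≥0∞) ≤ k := by exact_mod_cast hk
  exact not_lt.2 (hm.le.trans this)

/-- The mass of the boundary layer of a convex set tends to zero. -/
lemma tendsto_setLIntegral_layer {K S : Set (E n)} (hK : Convex ℝ K) (hKm : MeasurableSet K)
    (hS : MeasurableSet S) (hSK : S ⊆ K) {ρ : E n → ℝ≥0∞} (hρ : Measurable ρ)
    (hint : ∫⁻ x, ρ x ≠ ⊤) (w : E n) :
    Tendsto (fun t : ℝ => ∫⁻ x in {z | z ∈ S ∧ z + t • w ∉ K}, ρ x) (𝓝[>] 0) (𝓝 0) := by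
  have hm : ∀ t : ℝ, MeasurableSet {z | z ∈ S ∧ z + t • w ∉ K} := fun t =>
    hS.inter (measurable_add_const (t • w) hKm.compl)
  simp_rw [← lintegral_indicator (hm _)]
  rw [← lintegral_zero (μ := (volume : Measure (E n))) (α := E n)]
  refine tendsto_lintegral_filter_of_dominated_convergence ρ
    (Eventually.of_forall fun t => hρ.indicator (hm t))
    (Eventually.of_forall fun t => Eventually.of_forall fun y => indicator_le_self _ _ _) hint ?_
  -- The frontier of a convex set is Lebesgue null, and an interior point leaves the layer once `t`
  -- is small.
  have hfr : ∀ᵐ x ∂(volume : Measure (E n)), x ∉ frontier K :=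
    measure_eq_zero_iff_ae_notMem.1 (hK.addHaar_frontier volume)
  refine hfr.mono fun x hx => tendsto_const_nhds.congr' ?_
  by_cases hxK : x ∈ K
  · have hint : x ∈ interior K := by
      by_contra h
      exact hx ⟨subset_closure hxK, h⟩
    have hcont : Continuous fun t : ℝ => x + t • w := by fun_prop
    have h0 : ∀ᶠ t in 𝓝 (0 : ℝ), x + t • w ∈ interior K :=
      hcont.continuousAt.eventually (isOpen_interior.mem_nhds (by simpa using hint))
    filter_upwards [h0.filter_mono nhdsWithin_le_nhds] with t ht
    rw [indicator_of_notMem]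
    exact fun h => h.2 (interior_subset ht)
  · exact Eventually.of_forall fun t => (indicator_of_notMem (fun h => hxK (hSK h.1)) _).symm

/-- For a minimiser, the volume of the boundary layer of width `t` is `o(t)`. -/
lemma IsSolution.volume_layer_isLittleO (hn : 1 ≤ n) {α : ℝ}
    (hα : -(1 / (n : ℝ)) < α) (hα0 : α < 0) {ϱ₀ ϱs μ : Measure (E n)} (hμ : μ ∈ P₁ n)
    (hsol : IsSolution α μ ϱ₀) {ρ : E n → ℝ≥0∞} (hρ : Measurable ρ)
    (hs : ϱs.MutuallySingular volume) (hdec : ϱ₀ = volume.withDensity ρ + ϱs)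
    {K S : Set (E n)} (hK : Convex ℝ K) (hKm : MeasurableSet K)
    (hS : MeasurableSet S) (hSK : S ⊆ K) (hρK : ∀ x ∉ K, ρ x = 0) {δ : ℝ≥0∞} (hδ : δ ≠ 0)
    (hρS : ∀ x ∈ S, δ ≤ ρ x) (w : E n) :
    Tendsto (fun t : ℝ => volume {z | z ∈ S ∧ z + t • w ∉ K} / ENNReal.ofReal t)
      (𝓝[>] 0) (𝓝 0) := by
  have := hsol.1.1
  have hα1 : 0 < 1 - α := by linarith
  have hp : 0 < 1 / (1 - α) := one_div_pos.2 hα1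
  have hp1 : 1 / (1 - α) < 1 := by rw [div_lt_one hα1]; linarith
  set p := 1 / (1 - α)
  obtain ⟨κ, hκ0, hκ⟩ := exists_one_add_eq_two_mul_rpow hp1
  have hκt : κ ≠ ⊤ := by
    have h1 : (2 : ℝ≥0∞) * 2⁻¹ ^ p ≠ ⊤ := ENNReal.mul_ne_top (by simp)
      (ENNReal.rpow_ne_top_of_nonneg hp.le (by simp))
    rw [← hκ] at h1
    exact (ENNReal.add_ne_top.1 h1).2
  have hint : ∫⁻ x, ρ x ≠ ⊤ := by
    have h1 : volume.withDensity ρ univ ≤ ϱ₀ univ := by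
      rw [hdec, Measure.add_apply]; exact le_self_add
    rw [withDensity_apply _ MeasurableSet.univ, Measure.restrict_univ] at h1
    exact ne_top_of_le_ne_top (measure_ne_top ϱ₀ univ) h1
  -- Truncated at one because `δ` may be infinite and the constant must be divided out.
  set δ' : ℝ≥0∞ := min (δ ^ p) 1
  have hδ'0 : δ' ≠ 0 := by
    have : 0 < δ ^ p := ENNReal.rpow_pos_of_nonneg (pos_iff_ne_zero.2 hδ) hp.le
    exact (lt_min this one_pos).ne'
  have hδ't : δ' ≠ ⊤ := ne_top_of_le_ne_top ENNReal.one_ne_top (min_le_right _ _)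
  set B := ENNReal.ofReal (1 - α) * (κ * δ') with hB
  have hB0 : B ≠ 0 := mul_ne_zero (by simpa using hα0.trans one_pos) (mul_ne_zero hκ0 hδ'0)
  have hBt : B ≠ ⊤ := ENNReal.mul_ne_top ENNReal.ofReal_ne_top (ENNReal.mul_ne_top hκt hδ't)
  set L : ℝ → Set (E n) := fun t => {z | z ∈ S ∧ z + t • w ∉ K}
  have hm : ∀ t : ℝ, MeasurableSet (L t) := fun t =>
    hS.inter (measurable_add_const (t • w) hKm.compl)
  set a := B⁻¹ * (ENNReal.ofReal (-α) * ENNReal.ofReal ‖w‖) with ha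
  have hat : a ≠ ⊤ := ENNReal.mul_ne_top (ENNReal.inv_ne_top.2 hB0)
    (ENNReal.mul_ne_top ENNReal.ofReal_ne_top ENNReal.ofReal_ne_top)
  have key : ∀ k : ℕ, ∀ t : ℝ, 0 < t → volume (L t) / ENNReal.ofReal t ≤
      a * (k * (∫⁻ x in L t, ρ x) + ∫⁻ y in {y | (k : ℝ≥0∞) < ‖y‖ₑ}, ‖y‖ₑ ∂μ) := by
    intro k t ht
    have ht0 : ENNReal.ofReal t ≠ 0 := by simpa using ht
    have h := hsol.lintegral_rpow_le hn hα hα0 hμ hρ hs hdec (hm t) (v := t • w)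
      (fun x hx h => hx.2 (hSK h.1)) (fun x hx => hρK _ hx.2) hκ k (by simp)
    have hlow : δ' * volume (L t) ≤ ∫⁻ x in L t, ρ x ^ p := by
      rw [← setLIntegral_const]
      refine setLIntegral_mono' (hm t) fun x hx => (min_le_left _ _).trans ?_
      exact ENNReal.rpow_le_rpow (hρS x hx.1) hp.le
    rw [ENNReal.div_le_iff ht0 ENNReal.ofReal_ne_top, ha, mul_assoc, mul_assoc,
      mul_comm B⁻¹, ← div_eq_mul_inv, ENNReal.le_div_iff_mul_le (Or.inl hB0) (Or.inl hBt)]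
    calc volume (L t) * B = ENNReal.ofReal (1 - α) * (κ * (δ' * volume (L t))) := by
          rw [hB]; ring
      _ ≤ _ := mul_le_mul' le_rfl (mul_le_mul' le_rfl hlow)
      _ ≤ _ := h
      _ = _ := by
        rw [norm_smul, Real.norm_of_nonneg ht.le, ENNReal.ofReal_mul ht.le]; ring
  rw [ENNReal.tendsto_nhds_zero]
  intro ε hε
  have htail : Tendsto (fun k : ℕ => a * ∫⁻ y in {y | (k : ℝ≥0∞) < ‖y‖ₑ}, ‖y‖ₑ ∂μ) atTop (𝓝 0) := by
    simpa using ENNReal.Tendsto.const_mul (tendsto_setLIntegral_lt_enorm hμ.2) (Or.inr hat)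
  -- The threshold `k` is fixed first to make the tail of `μ` small. Only then does `t → 0` remove
  -- the term with the mass of the layer.
  obtain ⟨k, hk⟩ := (htail.eventually (gt_mem_nhds hε)).exists
  have hlim : Tendsto (fun t : ℝ => a * (k * (∫⁻ x in L t, ρ x) +
      ∫⁻ y in {y | (k : ℝ≥0∞) < ‖y‖ₑ}, ‖y‖ₑ ∂μ)) (𝓝[>] 0)
      (𝓝 (a * (k * 0 + ∫⁻ y in {y | (k : ℝ≥0∞) < ‖y‖ₑ}, ‖y‖ₑ ∂μ))) :=
    ENNReal.Tendsto.const_mul ((ENNReal.Tendsto.const_mul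
      (tendsto_setLIntegral_layer hK hKm hS hSK hρ hint w) (Or.inr (by simp))).add
      tendsto_const_nhds) (Or.inr hat)
  rw [mul_zero, zero_add] at hlim
  filter_upwards [hlim.eventually (gt_mem_nhds hk), eventually_mem_nhdsWithin] with t h1 h2
  exact (key k t h2).trans h1.le

/-! ### Interior of the domain and nullity on the frontier -/

/-- A convex set without interior lies in its own frontier and is Lebesgue null, so `ρ` would vanish
almost everywhere. -/
lemma IsSolution.nonempty_interior (hn : 1 ≤ n) {α : ℝ}
    (hα : -(1 / (n : ℝ)) < α) (hα0 : α < 0) {ϱ₀ ϱs μ : Measure (E n)} (hμ : μ ∈ P₁ n)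
    (hsol : IsSolution α μ ϱ₀) {ρ : E n → ℝ≥0∞} (hρ : Measurable ρ)
    (hs : ϱs.MutuallySingular volume) (hdec : ϱ₀ = volume.withDensity ρ + ϱs)
    {K : Set (E n)} (hK : Convex ℝ K) (hρK : ∀ x ∉ K, ρ x = 0) : (interior K).Nonempty := by
  rw [nonempty_iff_ne_empty]
  intro hempty
  refine hsol.lintegral_rnDeriv_rpow_ne_zero hn hα hα0 hμ ?_
  have hp : 0 < 1 / (1 - α) := one_div_pos.2 (by linarith)
  have hd : ρ =ᵐ[volume] ϱ₀.rnDeriv volume :=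
    Measure.eq_rnDeriv hρ hs (by rw [hdec, add_comm])
  have hfr : ∀ᵐ x ∂(volume : Measure (E n)), x ∉ frontier K :=
    measure_eq_zero_iff_ae_notMem.1 (hK.addHaar_frontier volume)
  rw [← lintegral_zero (μ := (volume : Measure (E n))) (α := E n)]
  refine lintegral_congr_ae ?_
  filter_upwards [hd, hfr] with x h1 h2
  have hx : x ∉ K := fun h => h2 ⟨subset_closure h, by simp [hempty]⟩
  rw [← h1, hρK x hx, ENNReal.zero_rpow_of_pos hp]

/-- The effective domain of `φ` meets the boundary of its closure in an `𝓗ⁿ⁻¹`-null set. -/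
lemma IsSolution.measure_frontier_eq_zero (hn : 1 ≤ n) {α : ℝ}
    (hα : -(1 / (n : ℝ)) < α) (hα0 : α < 0) {ϱ₀ ϱs μ : Measure (E n)} (hμ : μ ∈ P₁ n)
    (hsol : IsSolution α μ ϱ₀) (hconv : IsConvex φ) (hlsc : LowerSemicontinuous φ)
    (hs : ϱs.MutuallySingular volume)
    (hdec : ϱ₀ = volume.withDensity (density α (1 / α - 1) φ) + ϱs)
    (hne : (interior {x | φ x ≠ ⊤}).Nonempty) :
    μHE[n - 1] {x | x ∈ frontier (closure {x | φ x ≠ ⊤}) ∧ φ x ≠ ⊤} = 0 := by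
  have hq : 1 / α - 1 < 0 := by
    have := one_div_neg.2 hα0
    linarith
  set K := closure {x | φ x ≠ ⊤}
  have hK : Convex ℝ K := hconv.convex_dom.closure
  obtain ⟨x₀, r, j₀, hr, hball⟩ := hconv.exists_ball_subset_sublevel hne
  have hj : ∀ j : ℕ, j₀ ≤ j → μH[((n - 1 : ℕ) : ℝ)] {x | x ∈ frontier K ∧ φ x ≤ (j : ℝ)} = 0 := by
    intro j hj
    -- The shift direction `z₀ - x₀` works only within `r / 4` of `z₀`, so nullity is proved
    -- locally.
    refine measure_null_of_locally_null _ fun z₀ hz₀ => ?_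
    refine ⟨{x | x ∈ frontier K ∧ φ x ≤ (j : ℝ)} ∩ Metric.closedBall z₀ (r / 4),
      inter_mem_nhdsWithin _ (Metric.closedBall_mem_nhds _ (by positivity)), ?_⟩
    obtain ⟨δ, hδ, hδφ⟩ := exists_le_density (φ := φ) hα0 hq j
    have hSK : {x | φ x ≤ (j : ℝ)} ⊆ K := fun x hx =>
      subset_closure (ne_top_of_le_ne_top (EReal.coe_ne_top _) hx)
    have hb : Metric.ball x₀ r ⊆ {x | φ x ≤ (j : ℝ)} := hball.trans fun x hx =>
      le_trans hx (EReal.coe_le_coe_iff.2 (by exact_mod_cast hj))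
    refine hausdorffMeasure_eq_zero_of_volume_isLittleO hn (c := r / 4) (C := r + ‖z₀ - x₀‖)
      (L := fun t => {z | z ∈ {x | φ x ≤ (j : ℝ)} ∧ z + t • (z₀ - x₀) ∉ K})
      (by positivity) (by positivity) ?_ ?_
    · filter_upwards [eventually_mem_nhdsWithin,
        (gt_mem_nhds one_pos).filter_mono nhdsWithin_le_nhds] with t ht ht1 x hx
      exact ⟨_, ball_subset_layer hK (hconv.convex_sublevel j) hSK hb hx.1.1 hx.1.2 hx.2 ht ht1⟩
    · refine hsol.volume_layer_isLittleO hn hα hα0 hμ (measurable_density hα0 _ hlsc) hs hdec hK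
        isClosed_closure.measurableSet (hlsc.isClosed_preimage _).measurableSet hSK ?_ hδ hδφ _
      intro x hx
      rw [density_eq_zero_iff hα0 hq]
      by_contra h
      exact hx (subset_closure h)
  rw [Measure.euclideanHausdorffMeasure_def, Measure.smul_apply]
  have hnull : μH[((n - 1 : ℕ) : ℝ)] {x | x ∈ frontier K ∧ φ x ≠ ⊤} = 0 := by
    -- Levels start at `j₀` so that every sublevel set used contains the ball around `x₀`.
    refine measure_mono_null ?_ (measure_iUnion_null fun j : ℕ => hj (j₀ + j) (by omega))
    rintro x ⟨hx, hx'⟩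
    obtain ⟨k, hk⟩ := exists_nat_ge (φ x).toReal
    refine mem_iUnion.2 ⟨k, hx, (EReal.le_coe_toReal hx').trans (EReal.coe_le_coe_iff.2 ?_)⟩
    push_cast
    linarith [Nat.cast_nonneg (α := ℝ) j₀]
  rw [hnull, smul_zero]

/-- The density vanishes exactly where `φ = ⊤`, so on the frontier of its support it is nonzero only
on a null set. Only the sign of `p` matters, hence one argument covers both exponents. -/
lemma sphericalSurfaceAreaMeasure_density_eq_zero {α p : ℝ} (hα : α < 0) (hp : p < 0)
    (hlsc : LowerSemicontinuous φ)
    (h : μHE[n - 1] {x | x ∈ frontier (closure {x | φ x ≠ ⊤}) ∧ φ x ≠ ⊤} = 0) :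
    sphericalSurfaceAreaMeasure (density α p φ) = 0 := by
  have hsupp : tsupport (density α p φ) = closure {x | φ x ≠ ⊤} := by
    rw [tsupport]
    congr 1
    ext x
    simp [density_eq_zero_iff hα hp]
  have hzero : (μHE[n - 1].restrict (frontier (tsupport (density α p φ)))).withDensity
      (density α p φ) = 0 := by
    rw [withDensity_eq_zero_iff (measurable_density hα p hlsc).aemeasurable, hsupp,
      Filter.EventuallyEq, ae_restrict_iff' isClosed_frontier.measurableSet]
    refine measure_mono_null (fun x hx => ?_) h
    simp only [mem_compl_iff, mem_ofPred_eq, Classical.not_imp, Pi.zero_apply,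
      density_eq_zero_iff hα hp] at hx
    exact hx
  rw [sphericalSurfaceAreaMeasure, hzero, Measure.comap_zero, Measure.map_zero]

end AlphaConcave

theorem mainTheorem7 (n : ℕ) (hn : 1 ≤ n) (α : ℝ) (hα : -(1 / (n : ℝ)) < α) (hα0 : α < 0)
    (μ : Measure (AlphaConcave.E n)) (hμ : μ ∈ AlphaConcave.P₁ n)
    (hbar : ∫ y, y ∂μ = 0) (hhyp : AlphaConcave.NotSupportedInHyperplane μ)
    (φ₀ : AlphaConcave.E n → EReal) (hconv : AlphaConcave.IsConvex φ₀)
    (hlsc : LowerSemicontinuous φ₀) (hge : ∀ x, ((1 / α : ℝ) : EReal) ≤ φ₀ x)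
    (ϱ₀ ϱs : Measure (AlphaConcave.E n)) (hs : ϱs.MutuallySingular volume)
    (hdec : ϱ₀ = volume.withDensity (AlphaConcave.density α (1 / α - 1) φ₀) + ϱs)
    (hsol : AlphaConcave.IsSolution α μ ϱ₀) :
    AlphaConcave.EssentiallyContinuous φ₀ ∧
      AlphaConcave.sphericalSurfaceAreaMeasure (AlphaConcave.density α (1 / α - 1) φ₀) = 0 ∧
      AlphaConcave.sphericalSurfaceAreaMeasure (AlphaConcave.density α (1 / α) φ₀) = 0 := by
  have hα' : 1 / α < 0 := one_div_neg.2 hα0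
  have hq : 1 / α - 1 < 0 := by linarith
  have hne : (interior {x | φ₀ x ≠ ⊤}).Nonempty :=
    hsol.nonempty_interior hn hα hα0 hμ (AlphaConcave.measurable_density hα0 _ hlsc) hs hdec
      hconv.convex_dom fun x hx =>
        (AlphaConcave.density_eq_zero_iff hα0 hq).2 (not_not.1 hx)
  have hnull := hsol.measure_frontier_eq_zero hn hα hα0 hμ hconv hlsc hs hdec hne
  exact ⟨⟨hlsc, measure_mono_null (hconv.notContinuousAt_subset hlsc hne) hnull⟩,
    AlphaConcave.sphericalSurfaceAreaMeasure_density_eq_zero hα0 hq hlsc hnull,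
    AlphaConcave.sphericalSurfaceAreaMeasure_density_eq_zero hα0 hα' hlsc hnull⟩
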